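/- Let $n\ge 2$ and let $\overline{\mathbb R^n}=\mathbb R^n\cup\{\infty\}$ carry the chordal metric $h(x,y)=\frac{|x-y|}{\sqrt{1+|x|^2}\sqrt{1+|y|^2}}$, $h(x,\infty)=\frac1{\sqrt{1+|x|^2}}$. For $A,B\subset\overline{\mathbb R^n}$ put $h(A,B)=\inf_{x\in A,\,y\in B}h(x,y)$ and $h(A)=\sup_{x,y\in A}h(x,y)$. The boundary $\partial D$ of a domain (nonempty connected open set) $D\subset\mathbb R^n$ is taken in $\overline{\mathbb R^n}$; closures $\overline{D_0}$ are taken in $\mathbb R^n$. A continuum is a nonempty compact connected set. Put $S(y_0,r)=\{y:|y-y_0|=r\}$ and $A(y_0,r_1,r_2)=\{y:r_1<|y-y_0|<r_2\}$. For a family $\Gamma$ of paths in $\mathbb R^n$ let $M(\Gamma)=\inf_\rho\int_{\mathbb R^n}\rho^n\,dm$, the infimum being over all Borel $\rho:\mathbb R^n\to[0,\infty]$ with $\int_\gamma\rho\,|dx|\ge1$ for every locally rectifiable $\gamma\in\Gamma$. Let $D,D_0\subset\mathbb R^n$ be domains, let $E\subset D_0$ be compact, and let $Q:\mathbb R^n\to[0,\infty]$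 be Lebesgue measurable with $Q\equiv0$ outside $D_0$. For $f:D\to\mathbb R^n$ let $\Gamma_f(y_0,r_1,r_2)$ be the family of all paths $\gamma:[a,b]\to D$ such that $f(\gamma(a))\in S(y_0,r_1)$, $f(\gamma(b))\in S(y_0,r_2)$ and $f(\gamma(t))\in A(y_0,r_1,r_2)$ for $a<t<b$. The map $f$ satisfies the inverse Poletsky inequality at $y_0$ if $$M(\Gamma_f(y_0,r_1,r_2))\le\int_{A(y_0,r_1,r_2)\cap f(D)}Q(y)\,\eta^n(|y-y_0|)\,dm(y)$$ for all $0<r_1<r_2<\sup_{y\in f(D)}|y-y_0|$ and every Lebesgue measurable $\eta:(r_1,r_2)\to[0,\infty]$ with $\int_{r_1}^{r_2}\eta(r)\,dr\ge1$. Consider continuous, open, discrete mappings $f:D\to D_0$ that are closed as mappings onto their image, a domain $f(D)$ with $E\subset f(D)\subset D_0$, that satisfy the inverse Poletsky inequality at every $y_0\in\overline{D_0}$, and for which $f^{-1}(E)$ is a continuum. For $\delta>0$, such an $f$ belongs to $\mathfrak R^E_{Q,\delta}(D,D_0)$ if $h(f^{-1}(E))\ge\delta$, and to $\mathfrak F^E_{Q,\delta}(D,D_0)$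 if $h(f^{-1}(E),\partial D)\ge\delta$. A sequence of domains $D_m$, all containing one ball centred at a point $A_0$, converges to the kernel $D_0$ if for every subsequence $(D_{m_k})$ the domain $D_0$ is the largest among the domains $G\ni A_0$ such that every compact subset of $G$ lies in $D_{m_k}$ for all sufficiently large $k$. **Lemma.** Let $\delta>0$ and let $D,D_0,E,Q$ be as above. Assume that for every $y_0\in\overline{D_0}$ and all $0<r_1<r_2<\sup_{y\in D_0}|y-y_0|$ there is a set $E_1\subset[r_1,r_2]$ of positive Lebesgue measure such that $Q$ is integrable over $S(y_0,r)$ with respect to the Hausdorff measure $\mathcal H^{n-1}$ for every $r\in E_1$. Assume that no connected component of $\partial D$ is a single point. Let $f_m\in\mathfrak R^E_{Q,\delta}(D,D_0)$, $m=1,2,\dots$, be such that the domains $f_m(D)$ converge to the kernel $D_0$ (with respect to some point $A_0$). Then there is $\delta_*>0$ such that $h(f_m^{-1}(E),\partial D)\ge\delta_*$ for every $m$, i.e. $f_m\in\mathfrak F^E_{Q,\delta_*}(D,D_0)$ for every $m$. -/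

import Mathlib

open MeasureTheory Set Filter
open scoped ENNReal Topology

noncomputable section

namespace Approaching

/-- Euclidean `n`-space. -/
abbrev Eu (n : ℕ) : Type := EuclideanSpace ℝ (Fin n)

/-- The extended space `ℝⁿ ∪ {∞}`. -/
abbrev ExtEu (n : ℕ) : Type := OnePoint (Eu n)

/-- A domain: a nonempty connected open set. -/
def IsRegion {n : ℕ} (D : Set (Eu n)) : Prop := IsOpen D ∧ IsConnected D

/-! ### The chordal metric -/

/-- The chordal (spherical) metric on `ℝⁿ ∪ {∞}`. -/
def chordal {n : ℕ} : ExtEu n → ExtEu n → ℝ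
  | none, none => 0
  | some x, none => 1 / √(1 + ‖x‖ ^ 2)
  | none, some y => 1 / √(1 + ‖y‖ ^ 2)
  | some x, some y => ‖x - y‖ / (√(1 + ‖x‖ ^ 2) * √(1 + ‖y‖ ^ 2))

/-- The chordal distance `h(A, B) = inf h(x, y)` over `x ∈ A`, `y ∈ B`. -/
def chordalDist {n : ℕ} (A B : Set (ExtEu n)) : ℝ≥0∞ :=
  ⨅ x ∈ A, ⨅ y ∈ B, ENNReal.ofReal (chordal x y)

/-- The chordal diameter `h(A) = sup h(x, y)` over `x, y ∈ A`. -/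
def chordalDiam {n : ℕ} (A : Set (ExtEu n)) : ℝ≥0∞ :=
  ⨆ x ∈ A, ⨆ y ∈ A, ENNReal.ofReal (chordal x y)

/-- A subset of `ℝⁿ`, seen in the extended space. -/
def toExt {n : ℕ} (A : Set (Eu n)) : Set (ExtEu n) := (fun x : Eu n => (x : ExtEu n)) '' A

/-- The boundary of `D ⊆ ℝⁿ`, taken in the extended space. -/
def extBoundary {n : ℕ} (D : Set (Eu n)) : Set (ExtEu n) := frontier (toExt D)

/-- No connected component of the boundary is a single point. -/
def NondegenerateBoundary {n : ℕ} (D : Set (Eu n)) : Prop :=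
  ∀ x ∈ extBoundary D, (connectedComponentIn (extBoundary D) x).Nontrivial

/-! ### Paths and the conformal modulus -/

/-- A path `γ : [a, b] → ℝⁿ` (the values off `[a, b]` are irrelevant). -/
structure ClosedPath (n : ℕ) where
  a : ℝ
  b : ℝ
  le : a ≤ b
  toFun : ℝ → Eu n
  cont : ContinuousOn toFun (Icc a b)

/-- The length of a path. -/
def ClosedPath.length {n : ℕ} (γ : ClosedPath n) : ℝ≥0∞ :=
  eVariationOn γ.toFun (Icc γ.a γ.b)

/-- `∫_γ ρ |dx|` for a rectifiable path `γ`: the integral of `ρ` along the arc length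
parametrization of `γ` over `[0, length γ]`. -/
def ClosedPath.lineIntegral {n : ℕ} (γ : ClosedPath n) (ρ : Eu n → ℝ≥0∞) : ℝ≥0∞ :=
  ∫⁻ s in Icc 0 γ.length.toReal, ρ (naturalParameterization γ.toFun (Icc γ.a γ.b) γ.a s)

/-- `ρ ∈ adm Γ`. A path on a compact interval is locally rectifiable if and only if its length
is finite. -/
def Admissible {n : ℕ} (Γ : Set (ClosedPath n)) (ρ : Eu n → ℝ≥0∞) : Prop :=
  Measurable ρ ∧ ∀ γ ∈ Γ, γ.length ≠ ∞ → 1 ≤ γ.lineIntegral ρ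

/-- The modulus `M(Γ) = M_n(Γ)` of a family of paths. -/
def modulus {n : ℕ} (Γ : Set (ClosedPath n)) : ℝ≥0∞ :=
  ⨅ (ρ : Eu n → ℝ≥0∞) (_ : Admissible Γ ρ), ∫⁻ x, ρ x ^ n

/-- The spherical ring `A(y₀, r₁, r₂)`. -/
def ring {n : ℕ} (y₀ : Eu n) (r₁ r₂ : ℝ) : Set (Eu n) := {y | r₁ < dist y y₀ ∧ dist y y₀ < r₂}

/-- `β : [a, b] → ℝⁿ` starts in `S`, ends in `T` and runs in `G` in between. -/
def Joins {n : ℕ} (a b : ℝ) (β : ℝ → Eu n) (S T G : Set (Eu n)) : Prop :=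
  β a ∈ S ∧ β b ∈ T ∧ ∀ t ∈ Ioo a b, β t ∈ G

/-- `Γ_f(y₀, r₁, r₂)`: the paths in `D` whose image under `f` joins the spheres
`S(y₀, r₁)` and `S(y₀, r₂)` in the ring between them. -/
def ringFamily {n : ℕ} (D : Set (Eu n)) (f : Eu n → Eu n) (y₀ : Eu n) (r₁ r₂ : ℝ) :
    Set (ClosedPath n) :=
  {γ | (∀ t ∈ Icc γ.a γ.b, γ.toFun t ∈ D) ∧
    Joins γ.a γ.b (fun t => f (γ.toFun t)) (Metric.sphere y₀ r₁) (Metric.sphere y₀ r₂)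
      (ring y₀ r₁ r₂)}

/-- `sup |y - y₀|` over `y ∈ G`, possibly infinite. -/
def outerRadius {n : ℕ} (G : Set (Eu n)) (y₀ : Eu n) : ℝ≥0∞ := ⨆ y ∈ G, edist y y₀

/-- The inverse Poletsky inequality for `f` on `D` at the point `y₀`. For functions with values
in `[0, ∞]`, Lebesgue measurability is the same as `AEMeasurable`. -/
def InversePoletsky {n : ℕ} (D : Set (Eu n)) (f : Eu n → Eu n) (Q : Eu n → ℝ≥0∞)
    (y₀ : Eu n) : Prop :=
  ∀ r₁ r₂ : ℝ, 0 < r₁ → r₁ < r₂ → ENNReal.ofReal r₂ < outerRadius (f '' D) y₀ →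
    ∀ η : ℝ → ℝ≥0∞, AEMeasurable η (volume.restrict (Ioo r₁ r₂)) →
      1 ≤ ∫⁻ r in Ioo r₁ r₂, η r →
      modulus (ringFamily D f y₀ r₁ r₂) ≤
        ∫⁻ y in ring y₀ r₁ r₂ ∩ f '' D, Q y * η (dist y y₀) ^ n

/-! ### The classes of mappings

A mapping `D → ℝⁿ` is given by a function on `ℝⁿ` of which only the values on `D` matter. -/

/-- `f` is a continuous, open, discrete and closed mapping of `D` (closed: onto its image). -/
structure OpenDiscreteClosed {n : ℕ} (D : Set (Eu n)) (f : Eu n → Eu n) : Prop where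
  continuousOn : ContinuousOn f D
  isOpen_image : ∀ U ⊆ D, IsOpen U → IsOpen (f '' U)
  isDiscrete_fiber : ∀ y, IsDiscrete (D ∩ f ⁻¹' {y})
  isClosed_image : ∀ A, IsClosed A → ∃ C, IsClosed C ∧ f '' (D ∩ A) = f '' D ∩ C

/-- The requirements common to both classes below. -/
structure BaseClass {n : ℕ} (E : Set (Eu n)) (Q : Eu n → ℝ≥0∞) (D D₀ : Set (Eu n))
    (f : Eu n → Eu n) : Prop where
  openDiscreteClosed : OpenDiscreteClosed D f
  isRegion_image : IsRegion (f '' D)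
  subset_image : E ⊆ f '' D
  image_subset : f '' D ⊆ D₀
  inversePoletsky : ∀ y₀ ∈ closure D₀, InversePoletsky D f Q y₀

/-- A continuum: a nonempty compact connected set. -/
def IsContinuum {n : ℕ} (K : Set (Eu n)) : Prop := IsCompact K ∧ IsConnected K

/-- The class `𝔉`: `f⁻¹(E)` is a continuum at chordal distance at least `δ` from `∂D`. -/
def classF {n : ℕ} (E : Set (Eu n)) (Q : Eu n → ℝ≥0∞) (δ : ℝ) (D D₀ : Set (Eu n)) :
    Set (Eu n → Eu n) :=
  {f | BaseClass E Q D D₀ f ∧ IsContinuum (D ∩ f ⁻¹' E) ∧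
    ENNReal.ofReal δ ≤ chordalDist (toExt (D ∩ f ⁻¹' E)) (extBoundary D)}

/-- The class `ℜ`: `f⁻¹(E)` is a continuum of chordal diameter at least `δ`. -/
def classR {n : ℕ} (E : Set (Eu n)) (Q : Eu n → ℝ≥0∞) (δ : ℝ) (D D₀ : Set (Eu n)) :
    Set (Eu n → Eu n) :=
  {f | BaseClass E Q D D₀ f ∧ IsContinuum (D ∩ f ⁻¹' E) ∧
    ENNReal.ofReal δ ≤ chordalDiam (toExt (D ∩ f ⁻¹' E))}

/-! ### Kernel convergence -/

/-- `G` is a domain containing `A₀`, each compact subset of which lies in all but finitely many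
of the `Dm`. -/
def EventuallyCovered {n : ℕ} (A₀ : Eu n) (Dm : ℕ → Set (Eu n)) (G : Set (Eu n)) : Prop :=
  IsRegion G ∧ A₀ ∈ G ∧ ∀ K ⊆ G, IsCompact K → ∃ N, ∀ m ≥ N, K ⊆ Dm m

/-- `D₀` is the kernel of `Dm` with respect to `A₀`: the largest such domain. -/
def IsKernel {n : ℕ} (A₀ : Eu n) (Dm : ℕ → Set (Eu n)) (D₀ : Set (Eu n)) : Prop :=
  EventuallyCovered A₀ Dm D₀ ∧ ∀ G, EventuallyCovered A₀ Dm G → G ⊆ D₀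

/-- The domains `Dm` have a common ball around some point `A₀`, and every subsequence has `D₀`
as its kernel with respect to `A₀`. -/
def ConvergesToKernel {n : ℕ} (Dm : ℕ → Set (Eu n)) (D₀ : Set (Eu n)) : Prop :=
  ∃ A₀ : Eu n, (∃ r > 0, ∀ m, Metric.ball A₀ r ⊆ Dm m) ∧
    ∀ φ : ℕ → ℕ, StrictMono φ → IsKernel A₀ (fun k => Dm (φ k)) D₀

/-! ### Integrability over spheres -/

/-- For all `y₀` in the closure of `D₀` and `0 < r₁ < r₂ < sup |y - y₀|` over `y ∈ D₀`, the
function `Q` is integrable over `S(y₀, r)` with respect to the `(n-1)`-dimensional Hausdorff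
measure, for all `r` in a subset of `[r₁, r₂]` of positive measure. -/
def IntegrableOverSpheres {n : ℕ} (D₀ : Set (Eu n)) (Q : Eu n → ℝ≥0∞) : Prop :=
  ∀ y₀ ∈ closure D₀, ∀ r₁ r₂ : ℝ, 0 < r₁ → r₁ < r₂ → ENNReal.ofReal r₂ < outerRadius D₀ y₀ →
    ∃ E₁ ⊆ Icc r₁ r₂, NullMeasurableSet E₁ (volume : Measure ℝ) ∧ 0 < volume E₁ ∧
      ∀ r ∈ E₁,
        AEMeasurable Q ((Measure.hausdorffMeasure ((n : ℝ) - 1)).restrict (Metric.sphere y₀ r)) ∧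
        ∫⁻ y in Metric.sphere y₀ r, Q y ∂(Measure.hausdorffMeasure ((n : ℝ) - 1)) < ∞

end Approaching

end

noncomputable section

namespace Approaching

open Metric Module

open scoped Pointwise NNReal RealInnerProductSpace

/-! Write C_m = f_m⁻¹(E). Suppose the C_m with m large came arbitrarily close to a boundary point p.
The component K of p in the boundary is nondegenerate and C_m has chordal diameter at least δ. So
C_m and K would both meet every sphere S(x₀, r), a < r < b, with b / a as large as desired: x₀ = p
and small radii if p is finite, x₀ = 0 and large radii if p = ∞. A density whose integral is at
least 1 along all Lipschitz paths from C_m out of D then has ∫ ρⁿ ≥ c log (b / a), because paths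
inside these spheres already force it (`exists_mul_log_le_lintegral_pow`). Hence it is enough to
find such densities with mass bounded independently of m; `exists_nhds_disjoint` turns the bound
into a neighbourhood of p that misses all these C_m.

The densities come from `exists_uniform_density`. Since f_m is closed and discrete, the image of a
path leaving D leaves every compact subset of f_m(D). By kernel convergence a fixed compact
neighbourhood of E lies in f_m(D) for m ≥ N. Thus the image of a path from C_m out of D crosses one
of finitely many fixed rings centred on E. The inverse Poletsky inequality bounds the modulus of
each ring family, and the bound is finite and free of m when η lives on radii where the sphere
integrals of Q are bounded.

The finitely many remaining C_m are compact subsets of D, and compactness of the extended boundary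
makes the local bounds uniform. -/

/-! ### Polar coordinates; surface measure against Hausdorff measure -/

theorem measurable_lintegral_sphere {n : ℕ} {g : Eu n → ℝ≥0∞} (hg : Measurable g) (y₀ : Eu n) :
    Measurable fun r : ℝ => ∫⁻ θ, g (y₀ + r • (θ : Eu n))
      ∂(volume : Measure (Eu n)).toSphere := by
  apply Measurable.lintegral_prod_right' (f := fun p : ℝ × sphere (0 : Eu n) 1 =>
    g (y₀ + p.1 • (p.2 : Eu n)))
  fun_prop

/-- Integration in polar coordinates. -/
theorem lintegral_polar {n : ℕ} (hn : 1 ≤ n) {g : Eu n → ℝ≥0∞} (hg : Measurable g) :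
    ∫⁻ x, g x = ∫⁻ r in Ioi (0 : ℝ), ENNReal.ofReal (r ^ (n - 1)) *
      ∫⁻ θ, g (r • (θ : Eu n)) ∂(volume : Measure (Eu n)).toSphere := by
  have : Nontrivial (Eu n) := by
    have : Nonempty (Fin n) := ⟨⟨0, hn⟩⟩
    infer_instance
  have hdim : finrank ℝ (Eu n) = n := by simp
  have hmp := (volume : Measure (Eu n)).measurePreserving_homeomorphUnitSphereProd
  rw [hdim] at hmp
  calc ∫⁻ x, g x = ∫⁻ x : ({(0)}ᶜ : Set (Eu n)), g (x : Eu n) ∂(volume.comap Subtype.val) := by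
        rw [lintegral_subtype_comap (measurableSet_singleton _).compl, restrict_compl_singleton]
    _ = ∫⁻ x : sphere (0 : Eu n) 1 × Ioi (0 : ℝ), g ((x.2 : ℝ) • (x.1 : Eu n))
          ∂(volume.toSphere.prod (.volumeIoiPow (n - 1))) := by
        rw [← hmp.lintegral_comp (by fun_prop)]
        refine lintegral_congr fun x => ?_
        congr 1
        have := congrArg Subtype.val ((homeomorphUnitSphereProd (Eu n)).symm_apply_apply x)
        rw [← this]
        rfl
    _ = ∫⁻ r : Ioi (0 : ℝ), ∫⁻ θ, g ((r : ℝ) • (θ : Eu n))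
          ∂(volume : Measure (Eu n)).toSphere ∂(.volumeIoiPow (n - 1)) :=
        lintegral_prod_symm' _ (by fun_prop)
    _ = _ := by
        have hm := measurable_lintegral_sphere hg 0
        simp only [zero_add] at hm
        rw [Measure.volumeIoiPow, ← lintegral_subtype_comap measurableSet_Ioi,
          lintegral_withDensity_eq_lintegral_mul _ (by fun_prop) (by fun_prop)]
        rfl

/-- The cone over a subset of a ball of radius `d` has volume `O(d ^ (n - 1))`. -/
theorem volume_cone_le {n : ℕ} (hn : 1 ≤ n) {A : Set (Eu n)} {x : Eu n} {d : ℝ} (hd : 0 < d)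
    (hd1 : d ≤ 1) (hA : A ⊆ closedBall x d) :
    volume (Ioo (0 : ℝ) 1 • A) ≤
      ENNReal.ofReal (2 * (2 + ‖x‖) ^ n) * volume (ball (0 : Eu n) 1) *
        ENNReal.ofReal d ^ (n - 1) := by
  -- The cone stays within O(d) of the segment from 0 to x, so about 1 / d balls of radius O(d)
  -- cover it. Each has volume O(dⁿ), which leaves O(d ^ (n - 1)).
  have hsub : Ioo (0 : ℝ) 1 • A ⊆
      ⋃ k ∈ Finset.range (⌊1 / d⌋₊ + 1), closedBall (((k : ℝ) * d) • x) ((2 + ‖x‖) * d) := by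
    rintro _ ⟨t, ht, a, ha, rfl⟩
    have hk : (⌊t / d⌋₊ : ℝ) ≤ t / d := Nat.floor_le (div_nonneg ht.1.le hd.le)
    have hk' : t / d < ⌊t / d⌋₊ + 1 := Nat.lt_floor_add_one _
    rw [le_div_iff₀ hd] at hk
    rw [div_lt_iff₀ hd] at hk'
    simp only [mem_iUnion]
    refine ⟨⌊t / d⌋₊, Finset.mem_range.2 (Nat.lt_succ_of_le (Nat.floor_mono ?_)), ?_⟩
    · gcongr; exact ht.2.le
    · have h1 : dist a x ≤ d := hA ha
      rw [mem_closedBall, dist_eq_norm]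
      rw [dist_eq_norm] at h1
      calc ‖t • a - ((⌊t / d⌋₊ : ℝ) * d) • x‖
          = ‖t • (a - x) + (t - (⌊t / d⌋₊ : ℝ) * d) • x‖ := by congr 1; module
        _ ≤ t * ‖a - x‖ + (t - (⌊t / d⌋₊ : ℝ) * d) * ‖x‖ := by
            refine (norm_add_le _ _).trans_eq ?_
            rw [norm_smul, norm_smul, Real.norm_of_nonneg ht.1.le,
              Real.norm_of_nonneg (sub_nonneg.2 hk)]
        _ ≤ 1 * d + d * ‖x‖ := by
            gcongr
            · exact ht.2.le
            · linarith
        _ ≤ (2 + ‖x‖) * d := by nlinarith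
  have hcard : ((⌊1 / d⌋₊ + 1 : ℕ) : ℝ) * d ≤ 2 := by
    have : (⌊1 / d⌋₊ : ℝ) ≤ 1 / d := Nat.floor_le (by positivity)
    rw [le_div_iff₀ hd] at this
    push_cast
    linarith
  calc volume (Ioo (0 : ℝ) 1 • A)
      ≤ ∑ k ∈ Finset.range (⌊1 / d⌋₊ + 1),
          volume (closedBall (((k : ℝ) * d) • x) ((2 + ‖x‖) * d)) :=
        (measure_mono hsub).trans (measure_biUnion_finset_le _ _)
    _ = ((⌊1 / d⌋₊ + 1 : ℕ) : ℝ≥0∞) *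
          (ENNReal.ofReal (((2 + ‖x‖) * d) ^ n) * volume (ball (0 : Eu n) 1)) := by
        simp only [Measure.addHaar_closedBall _ _ (show 0 ≤ (2 + ‖x‖) * d by positivity),
          finrank_euclideanSpace, Fintype.card_fin, Finset.sum_const, Finset.card_range,
          nsmul_eq_mul]
    _ = ENNReal.ofReal (((⌊1 / d⌋₊ + 1 : ℕ) : ℝ) * d * (2 + ‖x‖) ^ n * d ^ (n - 1)) *
          volume (ball (0 : Eu n) 1) := by
        rw [← mul_assoc, ← ENNReal.ofReal_natCast, ← ENNReal.ofReal_mul (by positivity)]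
        congr 2
        obtain ⟨k, rfl⟩ : ∃ k, n = k + 1 := ⟨n - 1, by omega⟩
        simp only [add_tsub_cancel_right, mul_pow]
        ring
    _ ≤ ENNReal.ofReal (2 * (2 + ‖x‖) ^ n * d ^ (n - 1)) * volume (ball (0 : Eu n) 1) := by
        gcongr
    _ = _ := by
        rw [ENNReal.ofReal_mul (by positivity), ENNReal.ofReal_pow hd.le]
        ring

/-- The surface measure of a subset of diameter at most `d` of the unit sphere
is `O(d ^ (n - 1))`. -/
theorem toSphere_le_of_subset_closedBall {n : ℕ} (hn : 1 ≤ n) {A : Set (sphere (0 : Eu n) 1)}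
    (hmeas : MeasurableSet A) {x : sphere (0 : Eu n) 1} {d : ℝ} (hd : 0 < d)
    (hd1 : d ≤ 1) (hA : A ⊆ closedBall x d) :
    (volume : Measure (Eu n)).toSphere A ≤
      n * (ENNReal.ofReal (2 * 3 ^ n) * volume (ball (0 : Eu n) 1)) *
        ENNReal.ofReal d ^ (n - 1) := by
  rw [Measure.toSphere_apply' _ hmeas, finrank_euclideanSpace, Fintype.card_fin, mul_assoc]
  gcongr
  have := volume_cone_le hn (A := (↑) '' A) (x := (x : Eu n)) hd hd1 (by
    rintro _ ⟨a, ha, rfl⟩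
    exact hA ha)
  have hx : ‖(x : Eu n)‖ = 1 := by simp
  rw [hx] at this
  norm_num at this ⊢
  exact this

/-- The surface measure on a sphere is dominated by a multiple of the Hausdorff measure. -/
theorem exists_map_toSphere_le {n : ℕ} (hn : 2 ≤ n) (y₀ : Eu n) {r : ℝ} (hr : 0 < r) :
    ∃ C : ℝ≥0∞, C ≠ ∞ ∧
      (volume : Measure (Eu n)).toSphere.map (fun θ : sphere (0 : Eu n) 1 => y₀ + r • (θ : Eu n)) ≤
        C • Measure.hausdorffMeasure ((n : ℝ) - 1) := by
  set φ : sphere (0 : Eu n) 1 → Eu n := fun θ => y₀ + r • (θ : Eu n) with hφ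
  have hφm : Measurable φ := by fun_prop
  set C₁ : ℝ≥0∞ := n * (ENNReal.ofReal (2 * 3 ^ n) * volume (ball (0 : Eu n) 1)) with hC₁
  have hC₁t : C₁ ≠ ∞ := by
    refine ENNReal.mul_ne_top (ENNReal.natCast_ne_top n)
      (ENNReal.mul_ne_top ENNReal.ofReal_ne_top measure_ball_lt_top.ne)
  have hC₁0 : C₁ ≠ 0 := by
    refine mul_ne_zero (by simp; omega) (mul_ne_zero ?_ (measure_ball_pos _ _ one_pos).ne')
    simp
  set C : ℝ≥0∞ := C₁ * ENNReal.ofReal (r⁻¹) ^ (n - 1) with hC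
  have hCt : C ≠ ∞ := ENNReal.mul_ne_top hC₁t (by finiteness)
  have hC0 : C ≠ 0 := mul_ne_zero hC₁0 (pow_ne_zero _ (by simpa using hr))
  have key : ∀ (A : Set (Eu n)) (d : ℝ), IsClosed A → 0 < d → d ≤ r →
      Metric.ediam A ≤ ENNReal.ofReal d →
      volume.toSphere.map φ A ≤ C * ENNReal.ofReal d ^ (n - 1) := by
    intro A d hA hd hdr hdiam
    rw [Measure.map_apply hφm hA.measurableSet]
    rcases (φ ⁻¹' A).eq_empty_or_nonempty with h | ⟨x, hx⟩
    · simp [h]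
    · have := toSphere_le_of_subset_closedBall (by omega) (hφm hA.measurableSet) (x := x)
        (d := d / r) (by positivity) (by rwa [div_le_one hr]) (A := φ ⁻¹' A) (by
          intro y hy
          have h1 : edist (φ y) (φ x) ≤ ENNReal.ofReal d :=
            (Metric.edist_le_ediam_of_mem (s := A) hy hx).trans hdiam
          rw [edist_dist] at h1
          have h2 := (ENNReal.ofReal_le_ofReal_iff hd.le).1 h1
          simp only [hφ, dist_add_left, dist_smul₀, Real.norm_of_nonneg hr.le] at h2
          rw [mem_closedBall, le_div_iff₀ hr, mul_comm]
          exact h2)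
      refine this.trans_eq ?_
      rw [hC, div_eq_mul_inv, mul_comm d, ENNReal.ofReal_mul (p := r⁻¹) (by positivity), mul_pow,
        mul_assoc C₁]
  refine ⟨C, hCt, ?_⟩
  -- The Hausdorff measure is the largest measure dominated by diam ^ (n - 1) on sets of small
  -- diameter. Passing to closures makes `key` applicable to arbitrary sets.
  have hle : C⁻¹ • volume.toSphere.map φ ≤ Measure.hausdorffMeasure ((n : ℝ) - 1) := by
    refine Measure.le_mkMetric _ _ (ENNReal.ofReal r) (by simpa using hr) fun s hs => ?_
    rw [Measure.smul_apply, smul_eq_mul, ENNReal.inv_mul_le_iff hC0 hCt]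
    refine (measure_mono subset_closure).trans ?_
    rw [← Metric.ediam_closure] at hs ⊢
    have hfin : Metric.ediam (closure s) ≠ ∞ := ne_top_of_le_ne_top ENNReal.ofReal_ne_top hs
    have hcast : ((n : ℝ) - 1) = ((n - 1 : ℕ) : ℝ) := by
      rw [Nat.cast_sub (by omega)]; simp
    rw [hcast, ENNReal.rpow_natCast]
    -- Since `key` needs d > 0, sets of diameter zero are handled by letting d → 0; n ≥ 2 makes the
    -- power vanish in the limit.
    rcases eq_or_ne (Metric.ediam (closure s)) 0 with h0 | h0
    · have hlim : Tendsto (fun d : ℝ => C * ENNReal.ofReal d ^ (n - 1)) (𝓝[>] 0) (𝓝 (C * 0)) := by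
        refine ENNReal.Tendsto.const_mul ?_ (Or.inr hCt)
        have : Continuous fun d : ℝ => ENNReal.ofReal d ^ (n - 1) :=
          (ENNReal.continuous_pow _).comp ENNReal.continuous_ofReal
        have h := (this.tendsto 0).mono_left (nhdsWithin_le_nhds (s := Ioi 0))
        simpa [show n - 1 ≠ 0 by omega] using h
      rw [h0, zero_pow (by omega)]
      refine ge_of_tendsto hlim ?_
      filter_upwards [self_mem_nhdsWithin, nhdsWithin_le_nhds (Iio_mem_nhds hr)] with d hd hdr
      exact key _ d isClosed_closure hd hdr.le (by simp [h0])
    · have := key (closure s) (Metric.ediam (closure s)).toReal isClosed_closure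
        (ENNReal.toReal_pos h0 hfin) (ENNReal.toReal_le_of_le_ofReal hr.le hs)
        (by rw [ENNReal.ofReal_toReal hfin])
      rwa [ENNReal.ofReal_toReal hfin] at this
  intro s
  have := hle s
  rw [Measure.smul_apply, smul_eq_mul, ENNReal.inv_mul_le_iff hC0 hCt] at this
  simpa using this

/-- A function that is integrable over a sphere for the Hausdorff measure is integrable for the
surface measure. -/
theorem lintegral_sphere_lt_top {n : ℕ} (hn : 2 ≤ n) (y₀ : Eu n) {r : ℝ} (hr : 0 < r)
    {Q : Eu n → ℝ≥0∞}
    (hQ : ∫⁻ y in sphere y₀ r, Q y ∂(Measure.hausdorffMeasure ((n : ℝ) - 1)) < ∞) :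
    ∫⁻ θ, Q (y₀ + r • (θ : Eu n)) ∂(volume : Measure (Eu n)).toSphere < ∞ := by
  obtain ⟨C, hC, hle⟩ := exists_map_toSphere_le hn y₀ hr
  have hemb : MeasurableEmbedding fun θ : sphere (0 : Eu n) 1 => y₀ + r • (θ : Eu n) := by
    refine Continuous.measurableEmbedding (by fun_prop) fun a b hab => ?_
    exact Subtype.ext (smul_right_injective _ hr.ne' (add_left_cancel hab))
  rw [← hemb.lintegral_map]
  have hrange : ∀ᵐ y ∂((volume : Measure (Eu n)).toSphere.map
      fun θ : sphere (0 : Eu n) 1 => y₀ + r • (θ : Eu n)), y ∈ sphere y₀ r := by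
    refine (ae_map_iff (p := (· ∈ sphere y₀ r)) (by fun_prop)
      isClosed_sphere.measurableSet).2 (.of_forall fun θ => ?_)
    have : ‖(θ : Eu n)‖ = 1 := by simp
    simp [norm_smul, this, abs_of_pos hr]
  rw [← Measure.restrict_eq_self_of_ae_mem hrange]
  calc _ ≤ ∫⁻ y in sphere y₀ r, Q y ∂(C • Measure.hausdorffMeasure ((n : ℝ) - 1)) := by
        gcongr
    _ < ∞ := by
        rw [Measure.restrict_smul, lintegral_smul_measure]
        exact ENNReal.mul_lt_top hC.lt_top hQ

/-- Functions that agree almost everywhere agree almost everywhere on almost all spheres. -/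
theorem ae_lintegral_sphere_congr {n : ℕ} (hn : 1 ≤ n) (y₀ : Eu n) {Q Q' : Eu n → ℝ≥0∞}
    (h : Q =ᵐ[volume] Q') :
    ∀ᵐ r : ℝ, 0 < r → ∫⁻ θ, Q (y₀ + r • (θ : Eu n)) ∂(volume : Measure (Eu n)).toSphere =
      ∫⁻ θ, Q' (y₀ + r • (θ : Eu n)) ∂(volume : Measure (Eu n)).toSphere := by
  obtain ⟨N, hsub, hN, hN0⟩ := exists_measurable_superset_of_null (ae_iff.1 h)
  have hg : Measurable (N.indicator (1 : Eu n → ℝ≥0∞)) := measurable_one.indicator hN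
  have h0 : ∫⁻ x, N.indicator (1 : Eu n → ℝ≥0∞) (y₀ + x) = 0 := by
    rw [lintegral_add_left_eq_self (N.indicator (1 : Eu n → ℝ≥0∞)) y₀, lintegral_indicator_one hN,
      hN0]
  have hm := measurable_lintegral_sphere hg y₀
  rw [lintegral_polar hn (by fun_prop), lintegral_eq_zero_iff (by fun_prop), EventuallyEq,
    ae_restrict_iff' measurableSet_Ioi] at h0
  filter_upwards [h0] with r hr hr0
  have h1 := (mul_eq_zero.1 (hr hr0)).resolve_left (by simpa using pow_pos hr0 _)
  rw [lintegral_eq_zero_iff (by fun_prop)] at h1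
  refine lintegral_congr_ae ?_
  filter_upwards [h1] with θ hθ
  by_contra hne
  have : y₀ + r • (θ : Eu n) ∈ N := hsub hne
  simp [this] at hθ

/-! ### A radial weight with finite Poletsky integral -/

/-- A weight that turns the right-hand side of the inverse Poletsky inequality finite. -/
theorem exists_weight_lintegral_lt_top {n : ℕ} (hn : 2 ≤ n) {D₀ : Set (Eu n)} {Q : Eu n → ℝ≥0∞}
    (hQ : AEMeasurable Q volume) (hQint : IntegrableOverSpheres D₀ Q) {y₀ : Eu n}
    (hy₀ : y₀ ∈ closure D₀) {r₁ r₂ : ℝ} (h₁ : 0 < r₁) (h₁₂ : r₁ < r₂)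
    (h₂ : ENNReal.ofReal r₂ < outerRadius D₀ y₀) :
    ∃ η : ℝ → ℝ≥0∞, Measurable η ∧ 1 ≤ ∫⁻ r in Ioo r₁ r₂, η r ∧
      ∫⁻ y in ring y₀ r₁ r₂, Q y * η (dist y y₀) ^ n < ∞ := by
  obtain ⟨E₁, hE₁, hE₁m, hE₁pos, hE₁Q⟩ := hQint y₀ hy₀ r₁ r₂ h₁ h₁₂ h₂
  set Q' := hQ.mk Q
  have hQ'm : Measurable Q' := hQ.measurable_mk
  have hQQ' : Q =ᵐ[volume] Q' := hQ.ae_eq_mk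
  set q : ℝ → ℝ≥0∞ := fun r => ∫⁻ θ, Q' (y₀ + r • (θ : Eu n)) ∂(volume : Measure (Eu n)).toSphere
  have hqm : Measurable q := measurable_lintegral_sphere hQ'm y₀
  have hfin : ∀ᵐ r : ℝ, r ∈ E₁ → q r < ∞ := by
    filter_upwards [ae_lintegral_sphere_congr (by omega) y₀ hQQ'] with r hr hrE
    have hr0 : 0 < r := h₁.trans_le (hE₁ hrE).1
    simp only [q]
    rw [← hr hr0]
    exact lintegral_sphere_lt_top hn y₀ hr0 (hE₁Q r hrE).2
  -- Up to a null set, E₁ is the union over N of the sets where q ≤ N, so one of these has positive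
  -- measure. On a measurable part F of it, η is the constant 1 / |F|.
  obtain ⟨N, hN⟩ : ∃ N : ℕ, volume ({r | q r ≤ N} ∩ E₁) ≠ 0 := by
    by_contra! hcon
    have hnull : volume (⋃ N : ℕ, {r | q r ≤ N} ∩ E₁) = 0 := measure_iUnion_null hcon
    refine hE₁pos.ne' (measure_mono_null_ae ?_ hnull)
    filter_upwards [hfin] with r hr hrE
    obtain ⟨N, hN⟩ := ENNReal.exists_nat_gt (hr hrE).ne
    exact mem_iUnion.2 ⟨N, hN.le, hrE⟩
  obtain ⟨F, hFsub, hFm, hFae⟩ :=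
    ((measurableSet_le hqm (measurable_const (a := (N : ℝ≥0∞)))).nullMeasurableSet.inter
      hE₁m).exists_measurable_subset_ae_eq
  have hFpos : volume F ≠ 0 := by rwa [measure_congr hFae]
  have hFIcc : F ⊆ Icc r₁ r₂ := fun r hr => hE₁ (hFsub hr).2
  have hFfin : volume F ≠ ∞ := measure_ne_top_of_subset hFIcc measure_Icc_lt_top.ne
  set η : ℝ → ℝ≥0∞ := F.indicator fun _ => (volume F)⁻¹ with hη
  have hηm : Measurable η := measurable_const.indicator hFm
  refine ⟨η, hηm, ?_, ?_⟩
  · rw [setLIntegral_congr Ioo_ae_eq_Icc, hη, lintegral_indicator_const hFm,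
      Measure.restrict_apply hFm, inter_eq_left.2 hFIcc, ENNReal.inv_mul_cancel hFpos hFfin]
  calc ∫⁻ y in ring y₀ r₁ r₂, Q y * η (dist y y₀) ^ n
      ≤ ∫⁻ y, Q y * η (dist y y₀) ^ n := setLIntegral_le_lintegral _ _
    _ = ∫⁻ y, Q' y * η (dist y y₀) ^ n := by
        refine lintegral_congr_ae ?_
        filter_upwards [hQQ'] with y hy
        rw [hy]
    _ = ∫⁻ x, Q' (y₀ + x) * η (dist (y₀ + x) y₀) ^ n :=
        (lintegral_add_left_eq_self (fun y => Q' y * η (dist y y₀) ^ n) y₀).symm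
    _ = ∫⁻ r in Ioi (0 : ℝ), ENNReal.ofReal (r ^ (n - 1)) * (q r * η r ^ n) := by
        rw [lintegral_polar (by omega) (by fun_prop)]
        refine setLIntegral_congr_fun measurableSet_Ioi fun r hr => ?_
        have hr' : (0 : ℝ) < r := hr
        simp only [q]
        rw [← lintegral_mul_const _ (by fun_prop)]
        congr 1
        refine lintegral_congr fun θ => ?_
        have : ‖(θ : Eu n)‖ = 1 := by simp
        simp [norm_smul, this, abs_of_pos hr']
    _ ≤ ∫⁻ r in Ioi (0 : ℝ), F.indicator
          (fun _ => ENNReal.ofReal (r₂ ^ (n - 1)) * (N * ((volume F)⁻¹) ^ n)) r := by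
        refine lintegral_mono fun r => ?_
        by_cases hr : r ∈ F
        · have hr1 := hFIcc hr
          have hr0 : 0 ≤ r := h₁.le.trans hr1.1
          simp only [hη, indicator_of_mem hr]
          gcongr
          · exact hr1.2
          · exact (hFsub hr).1
        · simp [hη, hr, show n ≠ 0 by omega]
    _ ≤ ENNReal.ofReal (r₂ ^ (n - 1)) * (N * ((volume F)⁻¹) ^ n) * volume F := by
        rw [lintegral_indicator_const hFm]
        gcongr
        exact Measure.restrict_le_self
    _ < ∞ := by
        have : (volume F)⁻¹ ≠ ∞ := ENNReal.inv_ne_top.2 hFpos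
        finiteness

/-! ### Lower bound for densities that charge all paths in a sphere -/

theorem lintegral_comp_add_smul {n : ℕ} (c : Eu n) {t : ℝ} (ht : 0 < t) {F : Eu n → ℝ≥0∞}
    (hF : Measurable F) :
    ∫⁻ z, F (c + t • z) = ENNReal.ofReal ((t ^ n)⁻¹) * ∫⁻ w, F w := by
  have h := Measure.map_addHaar_smul (volume : Measure (Eu n)) ht.ne'
  calc ∫⁻ z, F (c + t • z) = ∫⁻ z, F (c + z) ∂(volume.map fun x : Eu n => t • x) :=
        (lintegral_map (f := fun z => F (c + z)) (by fun_prop) (by fun_prop)).symm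
    _ = _ := by
        rw [h, lintegral_smul_measure, lintegral_add_left_eq_self F c, smul_eq_mul]
        congr 2
        rw [finrank_euclideanSpace, Fintype.card_fin, abs_of_pos (by positivity)]

/-- The measure of the parameters `s` for which a moving ball of radius `t / 4` contains a given
point is at most `2 * t`. -/
theorem volume_moving_ball_le {n : ℕ} {q a w : Eu n} {t : ℝ} (ht : 0 < t) (hq : ‖q‖ = 1 - t) :
    volume (Icc (1 : ℝ) 2 ∩ {s | w ∈ ball (s • q + a) (t / 4)}) ≤ ENNReal.ofReal (2 * t) := by
  -- Two such parameters satisfy |s - s'| (1 - t) < t / 2, which is enough when t < 1 / 2. For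
  -- larger t the length of [1, 2] is already at most 2 t.
  rcases le_or_gt (1 / 2) t with h | h
  · refine (measure_mono inter_subset_left).trans ?_
    rw [Real.volume_Icc]
    exact ENNReal.ofReal_le_ofReal (by linarith)
  · refine (Real.volume_le_diam _).trans (Metric.ediam_le fun s hs s' hs' => ?_)
    rw [edist_dist]
    refine ENNReal.ofReal_le_ofReal ?_
    have h1 : dist (s • q + a) (s' • q + a) < t / 4 + t / 4 :=
      (dist_triangle_left _ _ w).trans_lt (add_lt_add hs.2 hs'.2)
    rw [dist_add_right, dist_eq_norm, ← sub_smul, norm_smul, hq, ← dist_eq_norm] at h1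
    have h2 : 0 ≤ dist s s' := dist_nonneg
    nlinarith

/-- Averaging over a ball and over a dilation parameter gains a factor `t`. -/
theorem lintegral_average_le {n : ℕ} {q z₀ : Eu n} {t : ℝ} (ht : 0 < t) (hq : ‖q‖ = 1 - t)
    (hz₀ : ‖z₀‖ = 1) {G : Eu n → ℝ≥0∞} (hG : Measurable G) :
    ∫⁻ s in Icc (1 : ℝ) 2, ∫⁻ z in ball z₀ (1 / 4), G (s • q + t • z) ≤
      ENNReal.ofReal (2 * t * (t ^ n)⁻¹) * ∫⁻ w in ball 0 4, G w := by
  have hq0 := norm_nonneg q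
  have hinner (s : ℝ) : ∫⁻ z in ball z₀ (1 / 4), G (s • q + t • z) =
      ENNReal.ofReal ((t ^ n)⁻¹) * ∫⁻ w, (ball (s • q + t • z₀) (t / 4)).indicator G w := by
    rw [← lintegral_comp_add_smul (s • q) ht (hG.indicator measurableSet_ball),
      ← lintegral_indicator measurableSet_ball]
    refine lintegral_congr fun z => ?_
    have : z ∈ ball z₀ (1 / 4) ↔ s • q + t • z ∈ ball (s • q + t • z₀) (t / 4) := by
      rw [mem_ball, mem_ball, dist_add_left, dist_smul₀, Real.norm_of_nonneg ht.le]
      constructor <;> intro h <;> nlinarith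
    by_cases hz : z ∈ ball z₀ (1 / 4)
    · rw [indicator_of_mem hz, indicator_of_mem (this.1 hz)]
    · rw [indicator_of_notMem hz, indicator_of_notMem (mt this.2 hz)]
  have hS : MeasurableSet {p : ℝ × Eu n | p.2 ∈ ball (p.1 • q + t • z₀) (t / 4)} := by
    simp only [mem_ball]
    exact measurableSet_lt (by fun_prop) (by fun_prop)
  simp_rw [hinner]
  rw [lintegral_const_mul' _ _ ENNReal.ofReal_ne_top, lintegral_lintegral_swap,
    mul_comm (2 * t), ENNReal.ofReal_mul (by positivity), mul_assoc]
  · gcongr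
    rw [← lintegral_const_mul' _ _ ENNReal.ofReal_ne_top, ← lintegral_indicator measurableSet_ball]
    refine lintegral_mono fun w => ?_
    by_cases hw : w ∈ ball (0 : Eu n) 4
    · rw [indicator_of_mem hw]
      calc ∫⁻ s in Icc (1 : ℝ) 2, (ball (s • q + t • z₀) (t / 4)).indicator G w
          = ∫⁻ s in Icc (1 : ℝ) 2,
              {s : ℝ | w ∈ ball (s • q + t • z₀) (t / 4)}.indicator (fun _ => G w) s := rfl
        _ = G w * volume (Icc (1 : ℝ) 2 ∩ {s | w ∈ ball (s • q + t • z₀) (t / 4)}) := by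
            have hm : MeasurableSet {s : ℝ | w ∈ ball (s • q + t • z₀) (t / 4)} := by
              simp only [mem_ball]
              exact measurableSet_lt (by fun_prop) (by fun_prop)
            rw [lintegral_indicator_const hm, Measure.restrict_apply hm, inter_comm]
        _ ≤ ENNReal.ofReal (2 * t) * G w := by
            rw [mul_comm]
            gcongr
            exact volume_moving_ball_le ht hq
    -- The centre of the moving ball has norm at most s (1 - t) + t ≤ 2, so the ball never reaches a
    -- point outside the ball of radius 4.
    · rw [indicator_of_notMem hw, nonpos_iff_eq_zero]
      refine (setLIntegral_congr_fun measurableSet_Icc fun s hs => ?_).trans (lintegral_zero)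
      refine indicator_of_notMem (fun hmem => hw ?_) _
      rw [mem_ball, dist_eq_norm] at hmem ⊢
      have h1 : ‖s • q + t • z₀‖ ≤ s * (1 - t) + t := by
        refine (norm_add_le _ _).trans_eq ?_
        rw [norm_smul, norm_smul, hq, hz₀, Real.norm_of_nonneg ht.le,
          Real.norm_of_nonneg (by linarith [hs.1]), mul_one]
      have h2 := norm_le_norm_add_norm_sub' w (s • q + t • z₀)
      rw [sub_zero]
      have h3 := hs.1
      have h4 := hs.2
      nlinarith
  · exact ((hG.comp measurable_snd).indicator hS).aemeasurable

/-- A substitute for Hölder's inequality: if a exceeds u, then (a / u) ^ (n - 1) ≥ 1. The threshold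
u may be chosen separately for each parameter τ. -/
theorem le_add_inv_pow_mul_pow {n : ℕ} (hn : 1 ≤ n) (a : ℝ≥0∞) {u : ℝ≥0∞} (hu0 : u ≠ 0)
    (hut : u ≠ ∞) : a ≤ u + u⁻¹ ^ (n - 1) * a ^ n := by
  rcases le_total a u with h | h
  · exact h.trans le_self_add
  · refine le_add_left ?_
    obtain ⟨k, rfl⟩ : ∃ k, n = k + 1 := ⟨n - 1, by omega⟩
    simp only [add_tsub_cancel_right, pow_succ, ← mul_assoc, ← mul_pow]
    have h1 : 1 ≤ u⁻¹ * a := by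
      rw [← ENNReal.inv_mul_cancel hu0 hut]
      gcongr
    calc a = 1 * a := (one_mul a).symm
      _ ≤ (u⁻¹ * a) ^ k * a := by gcongr; exact one_le_pow₀ h1

/-- The kernel `(1 - |τ|) ^ (-β)` is integrable on `[-1, 1]` for `β < 1`. -/
theorem lintegral_one_sub_abs_rpow_lt_top {β : ℝ} (hβ : β < 1) :
    ∫⁻ τ in Icc (-1 : ℝ) 1, ENNReal.ofReal ((1 - |τ|) ^ (-β)) < ∞ := by
  have h0 : IntervalIntegrable (fun x : ℝ => x ^ (-β)) volume 0 2 :=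
    intervalIntegral.intervalIntegrable_rpow' (by linarith)
  have h1 : IntegrableOn (fun τ : ℝ => (1 + τ) ^ (-β)) (Icc (-1) 1) := by
    have := h0.comp_add_left 1
    norm_num at this
    rwa [intervalIntegrable_iff_integrableOn_Icc_of_le (by norm_num)] at this
  have h2 : IntegrableOn (fun τ : ℝ => (1 - τ) ^ (-β)) (Icc (-1) 1) := by
    have := h0.comp_sub_left 1
    norm_num at this
    have := this.symm
    rwa [intervalIntegrable_iff_integrableOn_Icc_of_le (by norm_num)] at this
  refine lt_of_le_of_lt ?_ (h1.add h2).lintegral_lt_top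
  refine setLIntegral_mono' measurableSet_Icc fun τ hτ => ?_
  refine ENNReal.ofReal_le_ofReal ?_
  have h3 : 0 ≤ (1 + τ) ^ (-β) := Real.rpow_nonneg (by linarith [hτ.1]) _
  have h4 : 0 ≤ (1 - τ) ^ (-β) := Real.rpow_nonneg (by linarith [hτ.2]) _
  simp only [Pi.add_apply]
  rcases abs_cases τ with ⟨h, -⟩ | ⟨h, -⟩ <;> rw [h]
  · linarith
  · rw [sub_neg_eq_add]; linarith

/-- The broken line through `x`, `0` and `y`. -/
def brokenLine {n : ℕ} (x y : Eu n) (τ : ℝ) : Eu n := max (-τ) 0 • x + max τ 0 • y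

theorem brokenLine_of_nonpos {n : ℕ} (x y : Eu n) {τ : ℝ} (h : τ ≤ 0) :
    brokenLine x y τ = |τ| • x := by
  simp [brokenLine, h, abs_of_nonpos h]

theorem brokenLine_of_nonneg {n : ℕ} (x y : Eu n) {τ : ℝ} (h : 0 ≤ τ) :
    brokenLine x y τ = |τ| • y := by
  simp [brokenLine, h, abs_of_nonneg h]

theorem continuous_brokenLine {n : ℕ} (x y : Eu n) : Continuous (brokenLine x y) := by
  unfold brokenLine
  fun_prop

theorem norm_brokenLine {n : ℕ} {x y : Eu n} (hx : ‖x‖ = 1) (hy : ‖y‖ = 1) (τ : ℝ) :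
    ‖brokenLine x y τ‖ = |τ| := by
  rcases le_total τ 0 with h | h
  · rw [brokenLine_of_nonpos _ _ h, norm_smul, hx, mul_one, Real.norm_eq_abs, abs_abs]
  · rw [brokenLine_of_nonneg _ _ h, norm_smul, hy, mul_one, Real.norm_eq_abs, abs_abs]

/-- If the integral of `g` is at least `1` along all broken lines from `s • x` to `s • y` with
vertex `z` in a fixed ball, then the integral of `g ^ n` over a ball is bounded below. -/
theorem exists_le_lintegral_pow_of_brokenLine (n : ℕ) (hn : 2 ≤ n) :
    ∃ c : ℝ, 0 < c ∧ ∀ (g : Eu n → ℝ≥0∞) (x y z₀ : Eu n), Measurable g → ‖x‖ = 1 → ‖y‖ = 1 →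
      ‖z₀‖ = 1 →
      (∀ s ∈ Icc (1 : ℝ) 2, ∀ z ∈ ball z₀ (1 / 4),
        1 ≤ ∫⁻ τ in Icc (-1 : ℝ) 1, g (s • brokenLine x y τ + (1 - |τ|) • z)) →
      ENNReal.ofReal c ≤ ∫⁻ w in ball 0 4, g w ^ n := by
  have hn0 : (0 : ℝ) < n := by exact_mod_cast (by omega : 0 < n)
  -- With t = 1 - |τ| and u = ε t ^ (-β), the relation β n = n - 1 makes both terms of
  -- `le_add_inv_pow_mul_pow` of order t ^ (-β) after averaging. Averaging over z alone would give t
  -- ^ (-n) in place of t ^ (1 - n) and lead to β = 1, where the kernel is not integrable; this is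
  -- why s varies as well.
  set β : ℝ := (n - 1) / n with hβ
  have hβ1 : β < 1 := by rw [hβ, div_lt_one hn0]; linarith
  have hβn : β * (n - 1) + 1 - n = -β := by rw [hβ]; field_simp; ring
  set T : ℝ≥0∞ := ∫⁻ τ in Icc (-1 : ℝ) 1, ENNReal.ofReal ((1 - |τ|) ^ (-β)) with hT
  have hTfin : T < ∞ := lintegral_one_sub_abs_rpow_lt_top hβ1
  set T' : ℝ := T.toReal + 1 with hT'
  have hT'pos : 0 < T' := by positivity
  have hTT' : T ≤ ENNReal.ofReal T' := by
    rw [ENNReal.le_ofReal_iff_toReal_le hTfin.ne hT'pos.le]; linarith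
  -- This makes ε v T' = v / 2, so that the first term can be absorbed into the left-hand side v.
  set ε : ℝ := 1 / (2 * T') with hε
  have hεpos : 0 < ε := by positivity
  set v : ℝ := (volume (ball (0 : Eu n) (1 / 4))).toReal with hv
  have hvpos : 0 < v := ENNReal.toReal_pos (measure_ball_pos _ _ (by norm_num)).ne'
    measure_ball_lt_top.ne
  have hvol (z : Eu n) : volume (ball z (1 / 4)) = ENNReal.ofReal v := by
    rw [hv, ENNReal.ofReal_toReal measure_ball_lt_top.ne,
      Measure.addHaar_ball_center volume z (1 / 4)]
  set B : ℝ := 2 * (ε⁻¹) ^ (n - 1) * T' with hB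
  have hBpos : 0 < B := by positivity
  refine ⟨v / (2 * B), by positivity, fun g x y z₀ hg hx hy hz₀ h => ?_⟩
  set I := ∫⁻ w in ball 0 4, g w ^ n with hI
  rcases eq_or_ne I ∞ with hItop | hItop
  · rw [hItop]; exact le_top
  -- The hypothesis is integrated over s and z, and the order is exchanged so that each τ can be
  -- estimated separately.
  have hmain : ENNReal.ofReal v ≤ ENNReal.ofReal (ε * v) * T +
      ENNReal.ofReal (2 * (ε⁻¹) ^ (n - 1)) * I * T := by
    have hcont : Continuous fun p : (ℝ × Eu n) × ℝ =>
        p.1.1 • brokenLine x y p.2 + (1 - |p.2|) • p.1.2 := by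
      have := continuous_brokenLine x y
      fun_prop
    have hmeas : Measurable fun p : (ℝ × Eu n) × ℝ =>
        g (p.1.1 • brokenLine x y p.2 + (1 - |p.2|) • p.1.2) := hg.comp hcont.measurable
    set μ : Measure (ℝ × Eu n) :=
      (volume.restrict (Icc 1 2)).prod (volume.restrict (ball z₀ (1 / 4))) with hμ
    have hμuniv : μ univ = ENNReal.ofReal v := by
      rw [hμ, ← univ_prod_univ, Measure.prod_prod, Measure.restrict_apply_univ,
        Measure.restrict_apply_univ, hvol, Real.volume_Icc]
      norm_num
    have hμmem : ∀ᵐ p ∂μ, p ∈ Icc (1 : ℝ) 2 ×ˢ ball z₀ (1 / 4) := by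
      rw [hμ, Measure.prod_restrict]
      exact ae_restrict_mem (measurableSet_Icc.prod measurableSet_ball)
    have hslice : ∀ τ ∈ Ioo (-1 : ℝ) 1,
        ∫⁻ p, g (p.1 • brokenLine x y τ + (1 - |τ|) • p.2) ∂μ ≤
          (ENNReal.ofReal (ε * v) + ENNReal.ofReal (2 * (ε⁻¹) ^ (n - 1)) * I) *
            ENNReal.ofReal ((1 - |τ|) ^ (-β)) := by
      intro τ hτ
      have ht : 0 < 1 - |τ| := by rw [sub_pos, abs_lt]; exact hτ
      have hq : ‖brokenLine x y τ‖ = 1 - (1 - |τ|) := by rw [norm_brokenLine hx hy]; ring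
      set t := 1 - |τ|
      have hu : 0 < ε * t ^ (-β) := by positivity
      calc ∫⁻ p, g (p.1 • brokenLine x y τ + t • p.2) ∂μ
          ≤ ∫⁻ p, (ENNReal.ofReal (ε * t ^ (-β)) + (ENNReal.ofReal (ε * t ^ (-β)))⁻¹ ^ (n - 1) *
              g (p.1 • brokenLine x y τ + t • p.2) ^ n) ∂μ :=
            lintegral_mono fun p => le_add_inv_pow_mul_pow (by omega) _
              (by simpa using hu) ENNReal.ofReal_ne_top
        _ = ENNReal.ofReal (ε * t ^ (-β)) * ENNReal.ofReal v +
              (ENNReal.ofReal (ε * t ^ (-β)))⁻¹ ^ (n - 1) *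
              ∫⁻ s in Icc (1 : ℝ) 2, ∫⁻ z in ball z₀ (1 / 4), g (s • brokenLine x y τ + t • z) ^ n
              := by
            rw [lintegral_add_left measurable_const, lintegral_const, hμuniv,
              lintegral_const_mul _ (by fun_prop), hμ, lintegral_prod _ (by fun_prop)]
        _ ≤ ENNReal.ofReal (ε * t ^ (-β)) * ENNReal.ofReal v +
              (ENNReal.ofReal (ε * t ^ (-β)))⁻¹ ^ (n - 1) *
              (ENNReal.ofReal (2 * t * (t ^ n)⁻¹) * I) := by
            gcongr
            exact lintegral_average_le ht hq hz₀ (hg.pow_const n)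
        _ = _ := by
            have h1 : t * (t ^ n)⁻¹ = t ^ (1 - n : ℝ) := by
              rw [Real.rpow_sub ht, Real.rpow_one, Real.rpow_natCast, div_eq_mul_inv]
            have h2 : t ^ (β * ((n - 1 : ℕ) : ℝ)) * t ^ (1 - n : ℝ) = t ^ (-β) := by
              rw [← Real.rpow_add ht, Nat.cast_sub (by omega), Nat.cast_one, ← hβn]
              congr 1
              ring
            have h3 : (ε * t ^ (-β))⁻¹ ^ (n - 1) * (2 * t * (t ^ n)⁻¹) =
                2 * ε⁻¹ ^ (n - 1) * t ^ (-β) := by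
              rw [mul_inv, mul_pow, ← Real.rpow_neg ht.le, neg_neg, ← Real.rpow_mul_natCast ht.le,
                ← h2, ← h1]
              ring
            rw [add_mul, ← ENNReal.ofReal_inv_of_pos hu, ← ENNReal.ofReal_pow (by positivity),
              ← mul_assoc, ← ENNReal.ofReal_mul (p := (ε * t ^ (-β))⁻¹ ^ (n - 1)) (by positivity),
              h3, mul_right_comm (ENNReal.ofReal _) I,
              ← ENNReal.ofReal_mul (p := ε * t ^ (-β)) hu.le,
              ← ENNReal.ofReal_mul (p := ε * v) (by positivity),
              ← ENNReal.ofReal_mul (p := 2 * ε⁻¹ ^ (n - 1)) (by positivity), mul_right_comm ε]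
    calc ENNReal.ofReal v = ∫⁻ _, 1 ∂μ := by rw [lintegral_one, hμuniv]
      _ ≤ ∫⁻ p, (∫⁻ τ in Icc (-1 : ℝ) 1, g (p.1 • brokenLine x y τ + (1 - |τ|) • p.2)) ∂μ := by
          refine lintegral_mono_ae ?_
          filter_upwards [hμmem] with p hp
          exact h p.1 hp.1 p.2 hp.2
      _ = ∫⁻ τ in Icc (-1 : ℝ) 1, ∫⁻ p, g (p.1 • brokenLine x y τ + (1 - |τ|) • p.2) ∂μ :=
          lintegral_lintegral_swap hmeas.aemeasurable
      _ ≤ ∫⁻ τ in Icc (-1 : ℝ) 1, (ENNReal.ofReal (ε * v) +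
            ENNReal.ofReal (2 * (ε⁻¹) ^ (n - 1)) * I) * ENNReal.ofReal ((1 - |τ|) ^ (-β)) := by
          rw [setLIntegral_congr Ioo_ae_eq_Icc.symm, setLIntegral_congr Ioo_ae_eq_Icc.symm]
          exact setLIntegral_mono' measurableSet_Ioo hslice
      _ = _ := by
          rw [lintegral_const_mul' _ _ (by finiteness), add_mul]
  have hle := hmain.trans (add_le_add (mul_le_mul_right hTT' _) (mul_le_mul_right hTT' _))
  rw [← ENNReal.ofReal_toReal hItop, ← ENNReal.ofReal_mul (by positivity),
    ← ENNReal.ofReal_mul (by positivity), ← ENNReal.ofReal_mul (by positivity),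
    ← ENNReal.ofReal_add (by positivity) (by positivity),
    ENNReal.ofReal_le_ofReal_iff (by positivity)] at hle
  rw [ENNReal.ofReal_le_iff_le_toReal hItop, div_le_iff₀ (by positivity)]
  have hεv : ε * v * T' = v / 2 := by rw [hε]; field_simp
  rw [hεv] at hle
  have : 2 * ε⁻¹ ^ (n - 1) * I.toReal * T' = I.toReal * B := by rw [hB]; ring
  rw [this] at hle
  linarith

/-- A vector orthogonal to x - y, which exists as n ≥ 2, has equal inner products with x and y; its
sign can then be chosen. Broken lines with vertex near it avoid the origin. -/
theorem exists_unit_inner_nonneg {n : ℕ} (hn : 2 ≤ n) (x y : Eu n) :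
    ∃ z : Eu n, ‖z‖ = 1 ∧ 0 ≤ ⟪x, z⟫ ∧ 0 ≤ ⟪y, z⟫ := by
  have hne : (ℝ ∙ (x - y))ᗮ ≠ ⊥ := by
    intro h
    have h1 := (ℝ ∙ (x - y)).finrank_add_finrank_orthogonal
    rw [h, finrank_bot, finrank_euclideanSpace, Fintype.card_fin] at h1
    have h2 : finrank ℝ (ℝ ∙ (x - y)) ≤ 1 :=
      (finrank_span_le_card (R := ℝ) {x - y}).trans_eq (by simp)
    omega
  obtain ⟨z, hz, hz0⟩ := Submodule.exists_mem_ne_zero_of_ne_bot hne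
  have hxy : ⟪x, z⟫ = ⟪y, z⟫ := by
    have := Submodule.mem_orthogonal_singleton_iff_inner_right.1 hz
    rwa [inner_sub_left, sub_eq_zero] at this
  rcases le_total 0 ⟪x, z⟫ with h | h
  · refine ⟨‖z‖⁻¹ • z, norm_smul_inv_norm hz0, ?_, ?_⟩ <;> rw [inner_smul_right]
    · positivity
    · rw [← hxy]; positivity
  · refine ⟨‖z‖⁻¹ • -z, ?_, ?_, ?_⟩
    · rw [smul_neg, norm_neg]; exact norm_smul_inv_norm hz0
    all_goals rw [inner_smul_right, inner_neg_right]
    · have : 0 ≤ -⟪x, z⟫ := by linarith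
      positivity
    · have : 0 ≤ -⟪y, z⟫ := by linarith
      positivity

/-- With vertex z₀ the cross term is nonnegative, so the squared norm is at least τ² + (1 - |τ|)² ≥
1 / 2. Moving the vertex to z costs at most 1 / 4. The bound keeps the path where radial projection
is Lipschitz. -/
theorem third_le_norm_brokenLine_add {n : ℕ} {x y z z₀ : Eu n} (hx : ‖x‖ = 1) (hy : ‖y‖ = 1)
    (hz₀ : ‖z₀‖ = 1) (hxz : 0 ≤ ⟪x, z₀⟫) (hyz : 0 ≤ ⟪y, z₀⟫) (hz : z ∈ ball z₀ (1 / 4))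
    {s τ : ℝ} (hs : 1 ≤ s) (hτ : τ ∈ Icc (-1 : ℝ) 1) :
    1 / 3 ≤ ‖s • brokenLine x y τ + (1 - |τ|) • z‖ := by
  have ht : 0 ≤ 1 - |τ| := by rw [sub_nonneg, abs_le]; exact hτ
  have hτ0 := abs_nonneg τ
  have hinner : 0 ≤ ⟪brokenLine x y τ, z₀⟫ := by
    rcases le_total τ 0 with h | h
    · rw [brokenLine_of_nonpos _ _ h, inner_smul_left]; simp; positivity
    · rw [brokenLine_of_nonneg _ _ h, inner_smul_left]; simp; positivity
  have hsq : 1 / 2 ≤ ‖s • brokenLine x y τ + (1 - |τ|) • z₀‖ ^ 2 := by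
    rw [norm_add_sq_real, norm_smul, norm_smul, norm_brokenLine hx hy, hz₀, inner_smul_left,
      inner_smul_right, Real.norm_of_nonneg ht, Real.norm_of_nonneg (by linarith)]
    have h1 : 0 ≤ s * ((1 - |τ|) * ⟪brokenLine x y τ, z₀⟫) := by positivity
    have h2 : |τ| ^ 2 ≤ (s * |τ|) ^ 2 := by
      gcongr
      nlinarith
    simp only [conj_trivial]
    nlinarith [sq_nonneg (2 * |τ| - 1)]
  have h7 : 7 / 10 ≤ ‖s • brokenLine x y τ + (1 - |τ|) • z₀‖ := by
    by_contra! h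
    nlinarith [norm_nonneg (s • brokenLine x y τ + (1 - |τ|) • z₀)]
  have hdiff : ‖(s • brokenLine x y τ + (1 - |τ|) • z₀) -
      (s • brokenLine x y τ + (1 - |τ|) • z)‖ ≤ 1 / 4 := by
    rw [add_sub_add_left_eq_sub, ← smul_sub, norm_smul, Real.norm_of_nonneg ht, norm_sub_rev,
      ← dist_eq_norm]
    have := mem_ball.1 hz
    nlinarith [dist_nonneg (x := z) (y := z₀)]
  have := norm_sub_norm_le (s • brokenLine x y τ + (1 - |τ|) • z₀)
    (s • brokenLine x y τ + (1 - |τ|) • z)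
  linarith

theorem norm_normalize_sub_le {n : ℕ} {u v : Eu n} (hu : 1 / 3 ≤ ‖u‖) (hv : 1 / 3 ≤ ‖v‖) :
    ‖‖u‖⁻¹ • u - ‖v‖⁻¹ • v‖ ≤ 6 * ‖u - v‖ := by
  have hu0 : 0 < ‖u‖ := by linarith
  have hv0 : 0 < ‖v‖ := by linarith
  calc ‖‖u‖⁻¹ • u - ‖v‖⁻¹ • v‖ = ‖‖u‖⁻¹ • (u - v) + (‖u‖⁻¹ * (‖v‖ - ‖u‖)) • (‖v‖⁻¹ • v)‖ := by
        congr 1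
        have : ‖u‖⁻¹ * (‖v‖ - ‖u‖) * ‖v‖⁻¹ = ‖u‖⁻¹ - ‖v‖⁻¹ := by field_simp
        rw [smul_smul, this]
        module
    _ ≤ ‖u‖⁻¹ * ‖u - v‖ + ‖u‖⁻¹ * ‖u - v‖ := by
        refine (norm_add_le _ _).trans ?_
        have hv1 : ‖‖v‖⁻¹ • v‖ = 1 := norm_smul_inv_norm (norm_pos_iff.1 hv0)
        rw [norm_smul, norm_smul, hv1, mul_one, norm_mul, norm_inv, norm_norm, Real.norm_eq_abs]
        gcongr
        rw [abs_sub_comm]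
        exact abs_norm_sub_norm_le u v
    _ ≤ 3 * ‖u - v‖ + 3 * ‖u - v‖ := by
        have : ‖u‖⁻¹ ≤ 3 := by
          rw [inv_le_comm₀ hu0 (by norm_num)]
          linarith
        gcongr
    _ = _ := by ring

theorem norm_brokenLine_sub_le {n : ℕ} {x y : Eu n} (hx : ‖x‖ = 1) (hy : ‖y‖ = 1) (τ τ' : ℝ) :
    ‖brokenLine x y τ - brokenLine x y τ'‖ ≤ 2 * |τ - τ'| := by
  have h1 : |max (-τ) 0 - max (-τ') 0| ≤ |τ - τ'| := by
    have := abs_max_sub_max_le_abs (-τ) (-τ') 0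
    rwa [neg_sub_neg, abs_sub_comm τ'] at this
  have h2 : |max τ 0 - max τ' 0| ≤ |τ - τ'| := abs_max_sub_max_le_abs τ τ' 0
  calc ‖brokenLine x y τ - brokenLine x y τ'‖
      = ‖(max (-τ) 0 - max (-τ') 0) • x + (max τ 0 - max τ' 0) • y‖ := by
        congr 1; unfold brokenLine; module
    _ ≤ |max (-τ) 0 - max (-τ') 0| + |max τ 0 - max τ' 0| := by
        refine (norm_add_le _ _).trans_eq ?_
        rw [norm_smul, norm_smul, hx, hy, mul_one, mul_one, Real.norm_eq_abs, Real.norm_eq_abs]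
    _ ≤ _ := by linarith

/-- If the integral of `ρ` is at least `1` along all Lipschitz paths joining two given points
of the sphere of radius `r`, then the integral of `ρ ^ n` over this sphere is at least `c / r`. -/
theorem exists_le_lintegral_sphere_pow (n : ℕ) (hn : 2 ≤ n) :
    ∃ c : ℝ, 0 < c ∧ ∀ (ρ : Eu n → ℝ≥0∞) (x₀ x y : Eu n) (r : ℝ), Measurable ρ → 0 < r →
      ‖x‖ = 1 → ‖y‖ = 1 →
      (∀ (γ : ℝ → Eu n) (K : ℝ≥0), LipschitzOnWith K γ (Icc (-1) 1) → γ (-1) = x₀ + r • x →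
        γ 1 = x₀ + r • y → 1 ≤ K * ∫⁻ τ in Icc (-1 : ℝ) 1, ρ (γ τ)) →
      ENNReal.ofReal c ≤ ENNReal.ofReal (r ^ n) *
        ∫⁻ θ, ρ (x₀ + r • (θ : Eu n)) ^ n ∂(volume : Measure (Eu n)).toSphere := by
  obtain ⟨c, hc, H⟩ := exists_le_lintegral_pow_of_brokenLine n hn
  refine ⟨c / (36 ^ n * 4 ^ n), by positivity, fun ρ x₀ x y r hρ hr hx hy h => ?_⟩
  obtain ⟨z₀, hz₀, hxz, hyz⟩ := exists_unit_inner_nonneg hn x y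
  -- Here ρ is extended from the sphere to be constant on rays, so integrals of g along broken lines
  -- become integrals of ρ along their radial projections. The factor 36 r is the Lipschitz constant
  -- of the projected path: 6 from the broken line, 6 from normalization, r from scaling.
  set g : Eu n → ℝ≥0∞ := fun w => ENNReal.ofReal (36 * r) * ρ (x₀ + r • (‖w‖⁻¹ • w)) with hg
  have hgm : Measurable g := by fun_prop
  have hbd := H g x y z₀ hgm hx hy hz₀ fun s hs z hz => by
    set u : ℝ → Eu n := fun τ => s • brokenLine x y τ + (1 - |τ|) • z with hu
    have hs0 : 0 < s := by linarith [hs.1]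
    have hz2 : ‖z‖ ≤ 2 := by
      have h1 := mem_ball.1 hz
      have h2 := norm_le_norm_add_norm_sub' z z₀
      rw [← dist_eq_norm] at h2
      linarith
    have hulow : ∀ τ ∈ Icc (-1 : ℝ) 1, 1 / 3 ≤ ‖u τ‖ := fun τ hτ =>
      third_le_norm_brokenLine_add hx hy hz₀ hxz hyz hz hs.1 hτ
    have hulip (τ τ' : ℝ) : ‖u τ - u τ'‖ ≤ 6 * |τ - τ'| := by
      have h1 := norm_brokenLine_sub_le hx hy τ τ'
      have h2 : |(|τ'| - |τ|)| ≤ |τ - τ'| := by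
        rw [abs_sub_comm]; exact abs_abs_sub_abs_le_abs_sub τ τ'
      calc ‖u τ - u τ'‖
          = ‖s • (brokenLine x y τ - brokenLine x y τ') + (|τ'| - |τ|) • z‖ := by
            congr 1; simp only [hu]; module
        _ ≤ s * ‖brokenLine x y τ - brokenLine x y τ'‖ + |(|τ'| - |τ|)| * ‖z‖ := by
            refine (norm_add_le _ _).trans_eq ?_
            rw [norm_smul, norm_smul, Real.norm_of_nonneg hs0.le, Real.norm_eq_abs]
        _ ≤ 2 * (2 * |τ - τ'|) + |τ - τ'| * 2 := by
            gcongr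
            exact hs.2
        _ = _ := by ring
    have hlip : LipschitzOnWith (36 * r).toNNReal (fun τ => x₀ + r • (‖u τ‖⁻¹ • u τ))
        (Icc (-1) 1) := by
      refine LipschitzOnWith.of_dist_le_mul fun τ hτ τ' hτ' => ?_
      rw [dist_add_left, dist_smul₀, Real.norm_of_nonneg hr.le, dist_eq_norm, Real.dist_eq,
        Real.coe_toNNReal _ (by positivity)]
      have h1 := norm_normalize_sub_le (hulow τ hτ) (hulow τ' hτ')
      have h2 := hulip τ τ'
      have h3 : ‖‖u τ‖⁻¹ • u τ - ‖u τ'‖⁻¹ • u τ'‖ ≤ 36 * |τ - τ'| := by linarith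
      calc _ ≤ r * (36 * |τ - τ'|) := by gcongr
        _ = _ := by ring
    have hone := h _ _ hlip (by simp [hu, brokenLine, norm_smul, hx, abs_of_pos hs0, smul_smul,
      hs0.ne']) (by simp [hu, brokenLine, norm_smul, hy, abs_of_pos hs0, smul_smul, hs0.ne'])
    rw [← lintegral_const_mul' _ _ ENNReal.coe_ne_top] at hone
    exact hone
  have hpolar : ∫⁻ w in ball 0 4, g w ^ n ≤ ENNReal.ofReal (36 ^ n * 4 ^ n * r ^ n) *
      ∫⁻ θ, ρ (x₀ + r • (θ : Eu n)) ^ n ∂(volume : Measure (Eu n)).toSphere := by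
    rw [← lintegral_indicator measurableSet_ball,
      lintegral_polar (by omega) ((hgm.pow_const n).indicator measurableSet_ball)]
    set J := ∫⁻ θ, ρ (x₀ + r • (θ : Eu n)) ^ n ∂(volume : Measure (Eu n)).toSphere with hJ
    calc _ ≤ ∫⁻ t in Ioi (0 : ℝ), (Iio (4 : ℝ)).indicator
          (fun _ => ENNReal.ofReal (4 ^ (n - 1)) * (ENNReal.ofReal (36 * r) ^ n * J)) t := by
          refine setLIntegral_mono' measurableSet_Ioi fun t ht => ?_
          have ht0 : (0 : ℝ) < t := ht
          have hmem (θ : sphere (0 : Eu n) 1) : t • (θ : Eu n) ∈ ball (0 : Eu n) 4 ↔ t < 4 := by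
            simp [norm_smul, abs_of_pos ht0]
          by_cases ht4 : t < 4
          · rw [indicator_of_mem (show t ∈ Iio (4 : ℝ) from ht4)]
            gcongr
            rw [hJ, ← lintegral_const_mul' _ _ (by finiteness)]
            refine lintegral_mono fun θ => le_of_eq ?_
            rw [indicator_of_mem ((hmem θ).2 ht4), hg]
            simp [norm_smul, abs_of_pos ht0, smul_smul, ht0.ne', mul_pow]
          · simp only [indicator_of_notMem (mt (hmem _).1 ht4)]
            simp
      _ ≤ ENNReal.ofReal (4 ^ (n - 1)) * (ENNReal.ofReal (36 * r) ^ n * J) * ENNReal.ofReal 4 := by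
          rw [lintegral_indicator_const measurableSet_Iio,
            Measure.restrict_apply measurableSet_Iio, Iio_inter_Ioi, Real.volume_Ioo, sub_zero]
      _ = _ := by
          rw [← ENNReal.ofReal_pow (by positivity), mul_comm, ← mul_assoc, ← mul_assoc,
            ← ENNReal.ofReal_mul (by positivity), ← ENNReal.ofReal_mul (by positivity)]
          congr 2
          obtain ⟨k, rfl⟩ : ∃ k, n = k + 1 := ⟨n - 1, by omega⟩
          simp only [add_tsub_cancel_right, mul_pow]
          ring
  have hfin := hbd.trans hpolar
  rw [ENNReal.ofReal_mul (by positivity), mul_assoc] at hfin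
  rw [ENNReal.ofReal_div_of_pos (by positivity)]
  exact ENNReal.div_le_of_le_mul' hfin

/-- If for all `r ∈ (a, b)` the integral of `ρ` is at least `1` along all Lipschitz paths joining
two points of the sphere of radius `r`, then the integral of `ρ ^ n` is at least
`c * log (b / a)`. -/
theorem exists_mul_log_le_lintegral_pow (n : ℕ) (hn : 2 ≤ n) :
    ∃ c : ℝ, 0 < c ∧ ∀ (ρ : Eu n → ℝ≥0∞) (x₀ : Eu n) (a b : ℝ), Measurable ρ → 0 < a → a ≤ b →
      (∀ r ∈ Ioo a b, ∃ x ∈ sphere x₀ r, ∃ y ∈ sphere x₀ r,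
        ∀ (γ : ℝ → Eu n) (K : ℝ≥0), LipschitzOnWith K γ (Icc (-1) 1) → γ (-1) = x →
        γ 1 = y → 1 ≤ K * ∫⁻ τ in Icc (-1 : ℝ) 1, ρ (γ τ)) →
      ENNReal.ofReal (c * Real.log (b / a)) ≤ ∫⁻ x, ρ x ^ n := by
  obtain ⟨c, hc, H⟩ := exists_le_lintegral_sphere_pow n hn
  refine ⟨c, hc, fun ρ x₀ a b hρ ha hab h => ?_⟩
  have hsphere {r : ℝ} (hr : 0 < r) {x : Eu n} (hx : x ∈ sphere x₀ r) :
      ‖r⁻¹ • (x - x₀)‖ = 1 ∧ x = x₀ + r • r⁻¹ • (x - x₀) := by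
    constructor
    · rw [norm_smul, ← dist_eq_norm, mem_sphere.1 hx, norm_inv, Real.norm_of_nonneg hr.le,
        inv_mul_cancel₀ hr.ne']
    · rw [smul_inv_smul₀ hr.ne', add_sub_cancel]
  calc ENNReal.ofReal (c * Real.log (b / a)) = ∫⁻ r in Ioo a b, ENNReal.ofReal (c * (1 / r)) := by
        rw [setLIntegral_congr Ioo_ae_eq_Ioc, ← ofReal_integral_eq_lintegral_ofReal,
          ← intervalIntegral.integral_of_le hab, intervalIntegral.integral_const_mul,
          integral_one_div_of_pos ha (ha.trans_le hab)]
        · rw [← IntegrableOn, ← intervalIntegrable_iff_integrableOn_Ioc_of_le hab]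
          refine IntervalIntegrable.const_mul (intervalIntegral.intervalIntegrable_one_div
            (fun r hr => ?_) continuousOn_id) c
          rw [uIcc_of_le hab] at hr
          exact (ha.trans_le hr.1).ne'
        · filter_upwards [ae_restrict_mem measurableSet_Ioc] with r hr
          have : 0 < r := ha.trans hr.1
          positivity
    _ ≤ ∫⁻ r in Ioo a b, ENNReal.ofReal (r ^ (n - 1)) *
          ∫⁻ θ, ρ (x₀ + r • (θ : Eu n)) ^ n ∂(volume : Measure (Eu n)).toSphere := by
        refine setLIntegral_mono' measurableSet_Ioo fun r hr => ?_
        have hr0 : 0 < r := ha.trans hr.1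
        obtain ⟨x, hx, y, hy, hxy⟩ := h r hr
        obtain ⟨hx1, hx2⟩ := hsphere hr0 hx
        obtain ⟨hy1, hy2⟩ := hsphere hr0 hy
        have := H ρ x₀ _ _ r hρ hr0 hx1 hy1 fun γ K hγ h1 h2 =>
          hxy γ K hγ (h1.trans hx2.symm) (h2.trans hy2.symm)
        have hpow : r ^ n = r * r ^ (n - 1) := by
          rw [← pow_succ']; congr 1; omega
        rw [hpow, ENNReal.ofReal_mul hr0.le, mul_assoc] at this
        rw [mul_one_div, ENNReal.ofReal_div_of_pos hr0]
        exact ENNReal.div_le_of_le_mul' this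
    _ ≤ ∫⁻ r in Ioi (0 : ℝ), ENNReal.ofReal (r ^ (n - 1)) *
          ∫⁻ θ, ρ (x₀ + r • (θ : Eu n)) ^ n ∂(volume : Measure (Eu n)).toSphere :=
        lintegral_mono_set fun r hr => ha.trans hr.1
    _ = ∫⁻ x, ρ (x₀ + x) ^ n := 
        (lintegral_polar (g := fun x => ρ (x₀ + x) ^ n) (by omega) (by fun_prop)).symm
    _ = ∫⁻ x, ρ x ^ n := lintegral_add_left_eq_self (fun x => ρ x ^ n) x₀

/-! ### Line integrals along Lipschitz paths -/

theorem eVariationOn_le_of_lipschitzOnWith {n : ℕ} {γ : ℝ → Eu n} {K : ℝ≥0} {s : Set ℝ}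
    (hγ : LipschitzOnWith K γ s) {a b : ℝ} (ha : a ∈ s) (hb : b ∈ s) :
    eVariationOn γ (s ∩ Icc a b) ≤ K * ENNReal.ofReal (b - a) := by
  have h1 := (hγ.mono (inter_subset_left (t := Icc a b))).comp_eVariationOn_le
    (g := (id : ℝ → ℝ)) (mapsTo_id _)
  refine h1.trans ?_
  gcongr
  exact ((monotone_id.monotoneOn s).eVariationOn_eq ha hb).le

theorem ClosedPath.length_ne_top {n : ℕ} {γ : ClosedPath n} {K : ℝ≥0}
    (hγ : LipschitzOnWith K γ.toFun (Icc γ.a γ.b)) : γ.length ≠ ∞ := by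
  have := eVariationOn_le_of_lipschitzOnWith hγ (left_mem_Icc.2 γ.le) (right_mem_Icc.2 γ.le)
  rw [inter_self] at this
  exact ne_top_of_le_ne_top (by finiteness) this

/-- The integral along a `K`-Lipschitz path is at most `K` times the integral with respect to the
parameter. -/
theorem ClosedPath.lineIntegral_le {n : ℕ} {γ : ClosedPath n} {K : ℝ≥0}
    (hγ : LipschitzOnWith K γ.toFun (Icc γ.a γ.b)) (ρ : Eu n → ℝ≥0∞) :
    γ.lineIntegral ρ ≤ K * ∫⁻ t in Icc γ.a γ.b, ρ (γ.toFun t) := by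
  set I := Icc γ.a γ.b with hI
  have haI : γ.a ∈ I := left_mem_Icc.2 γ.le
  have hbI : γ.b ∈ I := right_mem_Icc.2 γ.le
  set V := variationOnFromTo γ.toFun I γ.a with hV
  have hbv : LocallyBoundedVariationOn γ.toFun I := hγ.locallyBoundedVariationOn
  have hVmono : MonotoneOn V I := variationOnFromTo.monotoneOn hbv haI
  have hVlip : LipschitzOnWith K V I := by
    refine LipschitzOnWith.of_le_add_mul K fun t ht s hs => ?_
    rcases le_total t s with h | h
    · have := hVmono ht hs h
      have h2 : 0 ≤ K * dist t s := by positivity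
      linarith
    · have h1 : V s + variationOnFromTo γ.toFun I s t = V t :=
        variationOnFromTo.add hbv haI hs ht
      rw [← h1, variationOnFromTo.eq_of_le _ _ h, Real.dist_eq, abs_of_nonneg (sub_nonneg.2 h)]
      gcongr
      refine ENNReal.toReal_le_of_le_ofReal (by have := sub_nonneg.2 h; positivity) ?_
      rw [ENNReal.ofReal_mul K.coe_nonneg, ENNReal.ofReal_coe_nnreal]
      exact eVariationOn_le_of_lipschitzOnWith hγ hs ht
  have hVa : V γ.a = 0 := variationOnFromTo.self _ _ _
  have hVb : V γ.b = γ.length.toReal := by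
    rw [hV, variationOnFromTo.eq_of_le _ _ γ.le, ← hI, inter_self]
    rfl
  have hVm : AEMeasurable V (volume.restrict I) :=
    aemeasurable_restrict_of_monotoneOn measurableSet_Icc hVmono
  -- The arc length function V maps I onto [0, length] and, being K-Lipschitz, expands length at
  -- most K times.
  have hle : volume.restrict (Icc 0 γ.length.toReal) ≤
      (K : ℝ≥0∞) • (volume.restrict I).map V := by
    refine Measure.le_iff.2 fun S hS => ?_
    rw [Measure.restrict_apply hS, Measure.smul_apply, smul_eq_mul,
      Measure.map_apply_of_aemeasurable hVm hS, Measure.restrict_apply' measurableSet_Icc]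
    have hsub : S ∩ Icc 0 γ.length.toReal ⊆ V '' (V ⁻¹' S ∩ I) := by
      rintro s ⟨hsS, hs⟩
      rw [← hVa, ← hVb] at hs
      obtain ⟨t, ht, rfl⟩ := intermediate_value_Icc γ.le hVlip.continuousOn hs
      exact ⟨t, ⟨hsS, ht⟩, rfl⟩
    have h1 := (hVlip.mono (inter_subset_right (s := V ⁻¹' S))).hausdorffMeasure_image_le
      zero_le_one
    rw [hausdorffMeasure_real, ENNReal.rpow_one] at h1
    exact (measure_mono hsub).trans h1
  calc γ.lineIntegral ρ
      ≤ ∫⁻ s, ρ (naturalParameterization γ.toFun I γ.a s) ∂((K : ℝ≥0∞) • (volume.restrict I).map V) :=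
        lintegral_mono' hle le_rfl
    _ ≤ K * ∫⁻ t in I, ρ (naturalParameterization γ.toFun I γ.a (V t)) := by
        rw [lintegral_smul_measure, smul_eq_mul]
        exact mul_le_mul_right
          (lintegral_map_le (fun s => ρ (naturalParameterization γ.toFun I γ.a s)) V) _
    _ = K * ∫⁻ t in I, ρ (γ.toFun t) := by
        congr 1
        refine setLIntegral_congr_fun measurableSet_Icc fun t ht => ?_
        rw [edist_eq_zero.1 (edist_naturalParameterization_eq_zero hbv haI ht)]

/-! ### Images of paths that leave D -/

/-- A closed discrete map takes no values of its image as limits at boundary points. -/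
theorem OpenDiscreteClosed.notMem_image_of_tendsto {n : ℕ} (hn : 1 ≤ n) {D : Set (Eu n)}
    (hD : IsOpen D) {f : Eu n → Eu n} (hf : OpenDiscreteClosed D f) {x : ℕ → Eu n} {p y : Eu n}
    (hx : ∀ k, x k ∈ D) (hxp : Tendsto x atTop (𝓝 p)) (hp : p ∉ D)
    (hfx : Tendsto (fun k => f (x k)) atTop (𝓝 y)) : y ∉ f '' D := by
  have : Nontrivial (Eu n) := by
    have : Nonempty (Fin n) := ⟨⟨0, hn⟩⟩
    infer_instance
  intro hy
  -- Since fibres are discrete, the points x k can be moved slightly off the fibre of y without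
  -- changing either limit.
  have hpert : ∀ k : ℕ, ∃ x' ∈ D, dist x' (x k) < 1 / ((k : ℝ) + 1) ∧
      dist (f x') (f (x k)) < 1 / ((k : ℝ) + 1) ∧ f x' ≠ y := by
    intro k
    have hk : (0 : ℝ) < 1 / ((k : ℝ) + 1) := by positivity
    by_cases hne : f (x k) = y
    · have hc : ContinuousAt f (x k) := hf.continuousOn.continuousAt (hD.mem_nhds (hx k))
      obtain ⟨U, hU, hUf⟩ : ∃ U ∈ 𝓝 (x k), U ∩ (D ∩ f ⁻¹' {y}) = {x k} := by
        have h1 := (hf.isDiscrete_fiber y)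
        have h2 := isDiscrete_iff_nhdsWithin.1 h1 (x k) ⟨hx k, hne⟩
        have h3 : {x k} ∈ 𝓝[D ∩ f ⁻¹' {y}] (x k) := by rw [h2]; exact mem_pure.2 rfl
        obtain ⟨U, hU, hsub⟩ := mem_nhdsWithin_iff_exists_mem_nhds_inter.1 h3
        exact ⟨U, hU, hsub.antisymm (by
          rintro _ rfl
          exact ⟨mem_of_mem_nhds hU, hx k, hne⟩)⟩
      have hev : ∀ᶠ x' in 𝓝[≠] (x k), x' ∈ U ∧ x' ∈ D ∧ dist x' (x k) < 1 / ((k : ℝ) + 1) ∧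
          dist (f x') (f (x k)) < 1 / ((k : ℝ) + 1) := by
        refine nhdsWithin_le_nhds ?_
        filter_upwards [hU, hD.mem_nhds (hx k), ball_mem_nhds (x k) hk,
          hc (ball_mem_nhds (f (x k)) hk)] with x' h1 h2 h3 h4
        exact ⟨h1, h2, h3, h4⟩
      obtain ⟨x', ⟨h1, h2, h3, h4⟩, h5⟩ := (hev.and self_mem_nhdsWithin).exists
      refine ⟨x', h2, h3, h4, fun h6 => h5 ?_⟩
      rw [← hUf]
      exact ⟨h1, h2, h6⟩
    · exact ⟨x k, hx k, by simpa using hk, by simpa using hk, hne⟩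
  choose x' hx'D hx'x hfx' hne using hpert
  have hlim : Tendsto (fun k : ℕ => 1 / ((k : ℝ) + 1)) atTop (𝓝 0) :=
    tendsto_one_div_add_atTop_nhds_zero_nat
  have hx'p : Tendsto x' atTop (𝓝 p) := by
    refine (tendsto_iff_of_dist ?_).2 hxp
    exact squeeze_zero (fun _ => dist_nonneg) (fun k => (hx'x k).le) hlim
  have hfy : Tendsto (fun k => f (x' k)) atTop (𝓝 y) := by
    refine (tendsto_iff_of_dist ?_).2 hfx
    exact squeeze_zero (fun _ => dist_nonneg) (fun k => (hfx' k).le) hlim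
  -- Closedness is applied to the points x' k together with p. The value y would be attained in this
  -- set, but p lies outside D and f (x' k) ≠ y.
  obtain ⟨C, hC, hCeq⟩ := hf.isClosed_image _ hx'p.isCompact_insert_range.isClosed
  have hmem (k : ℕ) : f (x' k) ∈ C := by
    have : f (x' k) ∈ f '' (D ∩ insert p (range x')) :=
      ⟨x' k, ⟨hx'D k, Or.inr ⟨k, rfl⟩⟩, rfl⟩
    rw [hCeq] at this
    exact this.2
  have hyC : y ∈ C := hC.mem_of_tendsto hfy (.of_forall hmem)
  have : y ∈ f '' (D ∩ insert p (range x')) := by rw [hCeq]; exact ⟨hy, hyC⟩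
  obtain ⟨w, ⟨hwD, rfl | ⟨k, rfl⟩⟩, hw⟩ := this
  · exact hp hwD
  · exact hne k hw

/-- The image of a path that leaves `D` leaves every compact subset of the image of `D`. -/
theorem OpenDiscreteClosed.exists_notMem_of_path {n : ℕ} (hn : 1 ≤ n) {D : Set (Eu n)}
    (hD : IsOpen D) {f : Eu n → Eu n} (hf : OpenDiscreteClosed D f) {γ : ℝ → Eu n} {a b : ℝ}
    (hab : a ≤ b) (hγ : ContinuousOn γ (Icc a b)) (ha : γ a ∈ D) (hb : γ b ∉ D) {F : Set (Eu n)}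
    (hF : IsCompact F) (hFD : F ⊆ f '' D) :
    ∃ T ∈ Icc a b, (∀ t ∈ Icc a T, γ t ∈ D) ∧ f (γ T) ∉ F := by
  set S := Icc a b ∩ γ ⁻¹' Dᶜ with hS
  have hSc : IsCompact S :=
    isCompact_Icc.of_isClosed_subset (hγ.preimage_isClosed_of_isClosed isClosed_Icc hD.isClosed_compl)
      inter_subset_left
  have hSne : S.Nonempty := ⟨b, right_mem_Icc.2 hab, hb⟩
  have hT₀ := hSc.sInf_mem hSne
  -- T₀ is the first exit time from D. If the image stayed in F before T₀, some of its values would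
  -- accumulate at a point of F ⊆ f(D) as the time tends to T₀, against `notMem_image_of_tendsto`.
  set T₀ := sInf S
  have hlt : ∀ t ∈ Ico a T₀, γ t ∈ D := fun t ht => by
    by_contra h
    exact (csInf_le hSc.bddBelow ⟨⟨ht.1, ht.2.le.trans hT₀.1.2⟩, h⟩).not_gt ht.2
  have haT : a < T₀ := hT₀.1.1.lt_of_ne fun h => hT₀.2 (h ▸ ha)
  by_contra! hcon
  have hin : ∀ t ∈ Ico a T₀, f (γ t) ∈ F := fun t ht =>
    hcon t ⟨ht.1, ht.2.le.trans hT₀.1.2⟩ fun s hs => hlt s ⟨hs.1, hs.2.trans_lt ht.2⟩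
  obtain ⟨t, -, htlt, ht⟩ := exists_seq_strictMono_tendsto' haT
  have htI (k : ℕ) : t k ∈ Ico a T₀ := ⟨(htlt k).1.le, (htlt k).2⟩
  obtain ⟨y, hyF, φ, hφ, hlim⟩ := hF.tendsto_subseq fun k => hin (t k) (htI k)
  have hγlim : Tendsto (fun k => γ (t (φ k))) atTop (𝓝 (γ T₀)) := by
    have h1 : Tendsto (fun k => t (φ k)) atTop (𝓝[Icc a b] T₀) :=
      tendsto_nhdsWithin_iff.2 ⟨ht.comp hφ.tendsto_atTop, .of_forall fun k =>
        ⟨(htI _).1, (htI _).2.le.trans hT₀.1.2⟩⟩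
    exact (hγ T₀ hT₀.1).tendsto.comp h1
  exact hf.notMem_image_of_tendsto hn hD (fun k => hlt _ (htI (φ k))) hγlim hT₀.2 hlim (hFD hyF)

/-- A continuous function that grows from below `r₁` to above `r₂` has a stretch on which it
grows from `r₁` to `r₂` with values strictly in between. -/
theorem exists_crossing {φ : ℝ → ℝ} {a T r₁ r₂ : ℝ} (haT : a ≤ T) (hφ : ContinuousOn φ (Icc a T))
    (h₁₂ : r₁ < r₂) (ha : φ a < r₁) (hT : r₂ < φ T) :
    ∃ a' b', a ≤ a' ∧ a' ≤ b' ∧ b' ≤ T ∧ φ a' = r₁ ∧ φ b' = r₂ ∧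
      ∀ t ∈ Ioo a' b', r₁ < φ t ∧ φ t < r₂ := by
  -- The endpoint b' is the first time at level r₂, and a' is the last time before b' at level r₁.
  set S := Icc a T ∩ φ ⁻¹' {r₂}
  have hSc : IsCompact S := isCompact_Icc.of_isClosed_subset
    (hφ.preimage_isClosed_of_isClosed isClosed_Icc isClosed_singleton) inter_subset_left
  have hSne : S.Nonempty := by
    obtain ⟨t, ht, h⟩ := intermediate_value_Icc haT hφ ⟨(ha.trans h₁₂).le, hT.le⟩
    exact ⟨t, ht, h⟩
  obtain ⟨⟨hb1, hb2⟩, hb⟩ := hSc.sInf_mem hSne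
  set b' := sInf S
  have hφb : φ b' = r₂ := hb
  have hφ' : ContinuousOn φ (Icc a b') := hφ.mono (Icc_subset_Icc_right hb2)
  have hlt : ∀ t ∈ Ico a b', φ t < r₂ := fun t ht => by
    by_contra! h
    obtain ⟨s, hs, hs'⟩ := intermediate_value_Icc ht.1
      (hφ'.mono (Icc_subset_Icc_right ht.2.le)) ⟨(ha.trans h₁₂).le, h⟩
    exact (csInf_le hSc.bddBelow (⟨⟨hs.1, hs.2.trans (ht.2.le.trans hb2)⟩, hs'⟩ : s ∈ S)).not_gt
      (hs.2.trans_lt ht.2)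
  set S' := Icc a b' ∩ φ ⁻¹' {r₁}
  have hSc' : IsCompact S' := isCompact_Icc.of_isClosed_subset
    (hφ'.preimage_isClosed_of_isClosed isClosed_Icc isClosed_singleton) inter_subset_left
  have hSne' : S'.Nonempty := by
    obtain ⟨t, ht, h⟩ := intermediate_value_Icc hb1 hφ' ⟨ha.le, by rw [hφb]; exact h₁₂.le⟩
    exact ⟨t, ht, h⟩
  obtain ⟨⟨ha1, ha2⟩, ha'⟩ := hSc'.sSup_mem hSne'
  set a' := sSup S'
  refine ⟨a', b', ha1, ha2, hb2, ha', hφb, fun t ht => ⟨?_, hlt t ⟨ha1.trans ht.1.le, ht.2⟩⟩⟩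
  by_contra! h
  obtain ⟨s, hs, hs'⟩ := intermediate_value_Icc ht.2.le
    (hφ'.mono (Icc_subset_Icc_left (ha1.trans ht.1.le))) ⟨h, by rw [hφb]; exact h₁₂.le⟩
  exact (le_csSup hSc'.bddAbove
    (⟨⟨ha1.trans (ht.1.le.trans hs.1), hs.2⟩, hs'⟩ : s ∈ S')).not_gt (ht.1.trans_le hs.1)

/-- A Lipschitz path that leaves `D` and whose image starts close to `y₀` contains a path of the
ring family at `y₀`. -/
theorem one_le_mul_lintegral_of_admissible {n : ℕ} (hn : 1 ≤ n) {D : Set (Eu n)} (hD : IsOpen D)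
    {f : Eu n → Eu n} (hf : OpenDiscreteClosed D f) {y₀ : Eu n} {r₁ r₂ : ℝ} (h₁₂ : r₁ < r₂)
    (hball : closedBall y₀ r₂ ⊆ f '' D) {ρ : Eu n → ℝ≥0∞}
    (hρ : Admissible (ringFamily D f y₀ r₁ r₂) ρ) {γ : ℝ → Eu n} {K : ℝ≥0} {a b : ℝ} (hab : a ≤ b)
    (hγ : LipschitzOnWith K γ (Icc a b)) (ha : γ a ∈ D) (hfa : f (γ a) ∈ ball y₀ r₁)
    (hb : γ b ∉ D) : 1 ≤ K * ∫⁻ t in Icc a b, ρ (γ t) := by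
  obtain ⟨T, hT, hTD, hTF⟩ := hf.exists_notMem_of_path hn hD hab hγ.continuousOn ha hb
    (isCompact_closedBall y₀ r₂) hball
  have hsubT : Icc a T ⊆ Icc a b := Icc_subset_Icc_right hT.2
  have hcont : ContinuousOn (fun t => dist (f (γ t)) y₀) (Icc a T) :=
    (by fun_prop : Continuous fun y : Eu n => dist y y₀).comp_continuousOn
      (hf.continuousOn.comp (hγ.continuousOn.mono hsubT) hTD)
  obtain ⟨a', b', haa', ha'b', hb'T, hra, hrb, hmid⟩ := exists_crossing hT.1 hcont h₁₂ hfa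
    (not_le.1 hTF)
  have hsub : Icc a' b' ⊆ Icc a T := Icc_subset_Icc haa' hb'T
  have hlip : LipschitzOnWith K γ (Icc a' b') := hγ.mono (hsub.trans hsubT)
  let β : ClosedPath n := ⟨a', b', ha'b', γ, hlip.continuousOn⟩
  have hβ : β ∈ ringFamily D f y₀ r₁ r₂ := ⟨fun t ht => hTD t (hsub ht), hra, hrb, hmid⟩
  calc 1 ≤ β.lineIntegral ρ := hρ.2 β hβ (ClosedPath.length_ne_top (γ := β) hlip)
    _ ≤ K * ∫⁻ t in Icc a' b', ρ (γ t) := ClosedPath.lineIntegral_le (γ := β) hlip ρ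
    _ ≤ _ := mul_le_mul_right (lintegral_mono_set (hsub.trans hsubT)) _

/-! ### Densities of mass bounded uniformly in m -/

theorem sup_pow_le_sum_pow {ι : Type*} (t : Finset ι) (g : ι → ℝ≥0∞) {n : ℕ} (hn : n ≠ 0) :
    t.sup g ^ n ≤ ∑ i ∈ t, g i ^ n := by
  rcases t.eq_empty_or_nonempty with rfl | ht
  · simp [hn]
  · obtain ⟨i, hi, h⟩ := t.exists_mem_eq_sup ht g
    rw [h]
    exact Finset.single_le_sum (f := fun i => g i ^ n) (fun _ _ => zero_le) hi

theorem lt_outerRadius_of_closedBall_subset {n : ℕ} (hn : 1 ≤ n) {G : Set (Eu n)} {y : Eu n}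
    {r ε : ℝ} (hr : 0 ≤ r) (hrε : r < ε) (hG : closedBall y ε ⊆ G) :
    ENNReal.ofReal r < outerRadius G y := by
  have : Nontrivial (Eu n) := by
    have : Nonempty (Fin n) := ⟨⟨0, hn⟩⟩
    infer_instance
  obtain ⟨w, hw⟩ := (NormedSpace.sphere_nonempty (x := y) (r := ε)).2 (hr.trans hrε.le)
  have hw' : dist w y = ε := hw
  have h1 : edist w y ≤ outerRadius G y :=
    le_iSup₂ (f := fun w (_ : w ∈ G) => edist w y) w (hG (sphere_subset_closedBall hw))
  refine lt_of_lt_of_le ?_ h1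
  rw [edist_dist, hw']
  exact (ENNReal.ofReal_lt_ofReal_iff (hr.trans_lt hrε)).2 hrε

/-- For all but finitely many `m` there is a density of bounded total mass which is admissible
for all Lipschitz paths that lead from `f_m⁻¹(E)` out of `D`. -/
theorem exists_uniform_density {n : ℕ} (hn : 2 ≤ n) {D D₀ : Set (Eu n)} (hD : IsOpen D)
    (hD₀ : IsOpen D₀) {E : Set (Eu n)} (hE : IsCompact E) (hED₀ : E ⊆ D₀) {Q : Eu n → ℝ≥0∞}
    (hQ : AEMeasurable Q volume) (hQint : IntegrableOverSpheres D₀ Q) {f : ℕ → Eu n → Eu n}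
    (hf : ∀ m, BaseClass E Q D D₀ (f m))
    (hcov : ∀ F ⊆ D₀, IsCompact F → ∃ N, ∀ m ≥ N, F ⊆ f m '' D) :
    ∃ (N : ℕ) (M : ℝ), ∀ m ≥ N, ∃ ρ : Eu n → ℝ≥0∞, Measurable ρ ∧
      ∫⁻ x, ρ x ^ n ≤ ENNReal.ofReal M ∧
      ∀ (γ : ℝ → Eu n) (K : ℝ≥0), LipschitzOnWith K γ (Icc (-1) 1) → γ (-1) ∈ D ∩ f m ⁻¹' E →
        γ 1 ∉ D → 1 ≤ K * ∫⁻ τ in Icc (-1 : ℝ) 1, ρ (γ τ) := by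
  -- Balls of radius ε / 4 will cover E, and the rings from ε / 4 to ε / 2 about their centres are
  -- crossed. The margin up to ε keeps ε / 2 below the outer radii of D₀ and f_m(D).
  obtain ⟨ε, hε, hεD⟩ := hE.exists_cthickening_subset_open hD₀ hED₀
  obtain ⟨N, hN⟩ := hcov _ hεD hE.cthickening
  have hballE : ∀ y ∈ E, closedBall y ε ⊆ cthickening ε E := fun y hy =>
    closedBall_subset_cthickening hy ε
  obtain ⟨t, htE, htfin, htcov⟩ := hE.finite_cover_balls (e := ε / 4) (by positivity)
  lift t to Finset (Eu n) using htfin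
  have hη : ∀ y : Eu n, ∃ η : ℝ → ℝ≥0∞, y ∈ t → Measurable η ∧
      1 ≤ ∫⁻ r in Ioo (ε / 4) (ε / 2), η r ∧
      ∫⁻ z in ring y (ε / 4) (ε / 2), Q z * η (dist z y) ^ n < ∞ := by
    intro y
    by_cases hy : y ∈ t
    · obtain ⟨η, h⟩ := exists_weight_lintegral_lt_top hn hQ hQint (y₀ := y)
        (r₁ := ε / 4) (r₂ := ε / 2) (subset_closure (hED₀ (htE hy))) (by positivity) (by linarith)
        (lt_outerRadius_of_closedBall_subset (by omega) (by positivity) (by linarith)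
          ((hballE y (htE hy)).trans hεD))
      exact ⟨η, fun _ => h⟩
    · exact ⟨0, fun h => absurd h hy⟩
  choose η hη using hη
  -- The added 1 makes the bound on each modulus strict, so that some admissible density satisfies
  -- it.
  set M : ℝ≥0∞ := ∑ y ∈ t, ((∫⁻ z in ring y (ε / 4) (ε / 2), Q z * η y (dist z y) ^ n) + 1) with hM
  have hMfin : M ≠ ∞ := by
    refine ENNReal.sum_ne_top.2 fun y hy => ENNReal.add_ne_top.2 ⟨(hη y hy).2.2.ne, by simp⟩
  refine ⟨N, M.toReal, fun m hm => ?_⟩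
  rw [ENNReal.ofReal_toReal hMfin]
  have hρ : ∀ y : Eu n, ∃ ρ : Eu n → ℝ≥0∞, y ∈ t →
      Admissible (ringFamily D (f m) y (ε / 4) (ε / 2)) ρ ∧
      ∫⁻ x, ρ x ^ n ≤ (∫⁻ z in ring y (ε / 4) (ε / 2), Q z * η y (dist z y) ^ n) + 1 := by
    intro y
    by_cases hy : y ∈ t
    · have h1 := (hf m).inversePoletsky y (subset_closure (hED₀ (htE hy))) (ε / 4) (ε / 2)
        (by positivity) (by linarith)
        (lt_outerRadius_of_closedBall_subset (by omega) (by positivity) (by linarith)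
          ((hballE y (htE hy)).trans (hN m hm))) (η y) (hη y hy).1.aemeasurable (hη y hy).2.1
      have h2 : modulus (ringFamily D (f m) y (ε / 4) (ε / 2)) <
          (∫⁻ z in ring y (ε / 4) (ε / 2), Q z * η y (dist z y) ^ n) + 1 := by
        refine (h1.trans (lintegral_mono_set inter_subset_left)).trans_lt ?_
        exact ENNReal.lt_add_right (hη y hy).2.2.ne one_ne_zero
      obtain ⟨ρ, h3⟩ := iInf_lt_iff.1 h2
      obtain ⟨hadm, h4⟩ := iInf_lt_iff.1 h3
      exact ⟨ρ, fun _ => ⟨hadm, h4.le⟩⟩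
    · exact ⟨0, fun h => absurd h hy⟩
  choose ρ hρ using hρ
  -- The maximum dominates each density, so it serves whichever ring is crossed, while its n-th
  -- power is at most the sum of the n-th powers.
  refine ⟨fun x => t.sup fun y => ρ y x, ?_, ?_, fun γ K hγ h1 h2 => ?_⟩
  · simp_rw [Finset.sup_eq_iSup]
    exact Measurable.biSup (t : Set (Eu n)) t.countable_toSet fun y hy => (hρ y hy).1.1
  · calc ∫⁻ x, (t.sup fun y => ρ y x) ^ n ≤ ∫⁻ x, ∑ y ∈ t, ρ y x ^ n :=
          lintegral_mono fun x => sup_pow_le_sum_pow t (fun y => ρ y x) (by omega)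
      _ = ∑ y ∈ t, ∫⁻ x, ρ y x ^ n :=
          lintegral_finsetSum' t fun y hy => ((hρ y hy).1.1.pow_const n).aemeasurable
      _ ≤ M := Finset.sum_le_sum fun y hy => (hρ y hy).2
  · obtain ⟨y, hy, hfy⟩ := mem_iUnion₂.1 (htcov h1.2)
    refine (one_le_mul_lintegral_of_admissible (by omega) hD (hf m).openDiscreteClosed
      (by linarith) (((closedBall_subset_closedBall (by linarith)).trans
        (hballE y (htE hy))).trans (hN m hm)) (hρ y hy).1 (by norm_num) hγ h1.1 hfy h2).trans ?_
    gcongr with τ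
    exact Finset.le_sup (f := fun y => ρ y (γ τ)) hy

/-! ### Connected sets and the chordal metric in the extended space -/

/-- A decreasing function of the distance to `c`, extended by `0` at infinity. -/
def radial {n : ℕ} (c : Eu n) : ExtEu n → ℝ
  | none => 0
  | some x => 1 / (1 + dist x c)

theorem radial_coe {n : ℕ} (c x : Eu n) : radial c (x : ExtEu n) = 1 / (1 + dist x c) := rfl

theorem radial_infty {n : ℕ} (c : Eu n) : radial c OnePoint.infty = 0 := rfl

theorem continuous_radial {n : ℕ} (c : Eu n) : Continuous (radial c) := by
  have h0 : ∀ x : Eu n, 1 + dist x c ≠ 0 := fun x => by positivity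
  refine continuous_iff_continuousAt.2 fun p => ?_
  induction p using OnePoint.rec with
  | infty =>
    rw [OnePoint.continuousAt_infty', coclosedCompact_eq_cocompact, radial_infty]
    have h1 : Tendsto (fun x : Eu n => 1 + dist x c) (cocompact (Eu n)) atTop :=
      tendsto_atTop_add_const_left _ _ (tendsto_dist_right_cocompact_atTop c)
    exact h1.inv_tendsto_atTop.congr fun x => by simp [radial_coe]
  | coe x =>
    rw [OnePoint.continuousAt_coe]
    have : Continuous fun x : Eu n => 1 / (1 + dist x c) := by fun_prop (disch := assumption)
    exact this.continuousAt

/-- A connected set in the extended space meets all spheres between two of its points. -/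
theorem exists_dist_eq_of_isPreconnected {n : ℕ} {S : Set (ExtEu n)} (hS : IsPreconnected S)
    {p q : ExtEu n} (hp : p ∈ S) (hq : q ∈ S) {c : Eu n} {r : ℝ} (hr : 0 ≤ r)
    (hqr : radial c q ≤ 1 / (1 + r)) (hrp : 1 / (1 + r) ≤ radial c p) :
    ∃ x : Eu n, (x : ExtEu n) ∈ S ∧ dist x c = r := by
  -- Because `radial c` is continuous at ∞ too, the intermediate value theorem applies to sets
  -- through ∞; the value 1 / (1 + r) is positive, so it is not taken there.
  obtain ⟨w, hw, hwr⟩ := hS.intermediate_value hq hp (continuous_radial c).continuousOn ⟨hqr, hrp⟩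
  induction w using OnePoint.rec with
  | infty =>
    rw [radial_infty] at hwr
    have : 0 < 1 / (1 + r) := by positivity
    linarith
  | coe x =>
    refine ⟨x, hw, ?_⟩
    rw [radial_coe, one_div, one_div, inv_inj] at hwr
    linarith

theorem notMem_of_mem_extBoundary {n : ℕ} {D : Set (Eu n)} (hD : IsOpen D) {x : Eu n}
    (hx : (x : ExtEu n) ∈ extBoundary D) : x ∉ D := fun h => by
  have hopen : IsOpen (toExt D) := OnePoint.isOpenEmbedding_coe.isOpenMap D hD
  have : (x : ExtEu n) ∈ toExt D ∩ frontier (toExt D) := ⟨⟨x, h, rfl⟩, hx⟩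
  rw [hopen.inter_frontier_eq] at this
  exact this

theorem chordal_coe_coe {n : ℕ} (x y : Eu n) : chordal (x : ExtEu n) (y : ExtEu n) =
    ‖x - y‖ / (√(1 + ‖x‖ ^ 2) * √(1 + ‖y‖ ^ 2)) := rfl

theorem chordal_coe_infty {n : ℕ} (x : Eu n) :
    chordal (x : ExtEu n) OnePoint.infty = 1 / √(1 + ‖x‖ ^ 2) := rfl

theorem one_le_sqrt_one_add_sq (a : ℝ) : 1 ≤ √(1 + a ^ 2) :=
  Real.one_le_sqrt.2 (by nlinarith [sq_nonneg a])

theorem sqrt_one_add_sq_le {a : ℝ} (ha : 0 ≤ a) : √(1 + a ^ 2) ≤ 1 + a :=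
  Real.sqrt_le_iff.2 ⟨by positivity, by nlinarith⟩

theorem le_sqrt_one_add_sq (a : ℝ) : a ≤ √(1 + a ^ 2) :=
  Real.le_sqrt_of_sq_le (by linarith)

theorem chordal_le_dist {n : ℕ} (x y : Eu n) : chordal (x : ExtEu n) y ≤ dist x y := by
  rw [chordal_coe_coe, dist_eq_norm]
  refine div_le_self (norm_nonneg _) ?_
  nlinarith [one_le_sqrt_one_add_sq ‖x‖, one_le_sqrt_one_add_sq ‖y‖]

theorem chordal_le_inv_add_inv {n : ℕ} {x y : Eu n} {R : ℝ} (hR : 0 < R) (hx : R ≤ ‖x‖)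
    (hy : R ≤ ‖y‖) : chordal (x : ExtEu n) y ≤ 2 / R := by
  rw [chordal_coe_coe]
  have hx0 : 0 < ‖x‖ := by linarith
  have hy0 : 0 < ‖y‖ := by linarith
  calc ‖x - y‖ / (√(1 + ‖x‖ ^ 2) * √(1 + ‖y‖ ^ 2)) ≤ (‖x‖ + ‖y‖) / (‖x‖ * ‖y‖) := by
        gcongr
        · exact norm_sub_le x y
        · exact le_sqrt_one_add_sq _
        · exact le_sqrt_one_add_sq _
    _ = 1 / ‖y‖ + 1 / ‖x‖ := by field_simp
    _ ≤ 1 / R + 1 / R := by gcongr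
    _ = 2 / R := by ring

/-- A set whose points have pairwise chordal distance at most `κ < δ` does not have chordal
diameter at least `δ`. -/
theorem exists_lt_chordal_of_le_chordalDiam {n : ℕ} {C : Set (Eu n)} {κ δ : ℝ}
    (hδ : 0 < δ) (hκ : κ < δ) (hC : ENNReal.ofReal δ ≤ chordalDiam (toExt C)) :
    ∃ x ∈ C, ∃ y ∈ C, κ < chordal (x : ExtEu n) y := by
  by_contra! h
  refine (hC.trans (?_ : _ ≤ ENNReal.ofReal κ)).not_gt ((ENNReal.ofReal_lt_ofReal_iff hδ).2 hκ)
  refine iSup₂_le ?_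
  rintro _ ⟨x, hx, rfl⟩
  refine iSup₂_le ?_
  rintro _ ⟨y, hy, rfl⟩
  exact ENNReal.ofReal_le_ofReal (h x hx y hy)

/-- The chordal distance of points near `p` to points off a neighbourhood of `p` is bounded
below. -/
theorem exists_le_chordal {n : ℕ} {p : ExtEu n} {U : Set (ExtEu n)} (hU : U ∈ 𝓝 p) :
    ∃ V ∈ 𝓝 p, ∃ κ : ℝ, 0 < κ ∧ ∀ x : Eu n, (x : ExtEu n) ∉ U → ∀ y ∈ V,
      κ ≤ chordal (x : ExtEu n) y := by
  induction p using OnePoint.rec with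
  | infty =>
    have h1 : ((↑) : Eu n → ExtEu n) ⁻¹' U ∈ cocompact (Eu n) := by
      rw [← coclosedCompact_eq_cocompact]
      exact OnePoint.tendsto_coe_infty hU
    obtain ⟨R, hR⟩ := (mem_cocompact_iff_closedBall_compl_subset (0 : Eu n)).1 h1
    set R' := max R 0
    have hR' : 0 ≤ R' := le_max_right _ _
    have hV : (((↑) : Eu n → ExtEu n) '' closedBall 0 (2 * R' + 1))ᶜ ∈ 𝓝 OnePoint.infty :=
      (OnePoint.isOpen_compl_image_coe.2 ⟨isClosed_closedBall, isCompact_closedBall _ _⟩).mem_nhds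
        (OnePoint.infty_notMem_image_coe)
    refine ⟨_, hV, 1 / (2 * (1 + R')), by positivity, fun x hx y hy => ?_⟩
    have hxR : ‖x‖ ≤ R' := by
      by_contra! h
      exact hx (hR (by simpa using (le_max_left _ _).trans_lt h))
    have hx1 : √(1 + ‖x‖ ^ 2) ≤ 1 + R' := (sqrt_one_add_sq_le (norm_nonneg x)).trans (by linarith)
    have hx0 : 0 < √(1 + ‖x‖ ^ 2) := one_pos.trans_le (one_le_sqrt_one_add_sq _)
    induction y using OnePoint.rec with
    | infty =>
      rw [chordal_coe_infty]
      gcongr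
      linarith
    | coe y =>
      have hyR : 2 * R' + 1 < ‖y‖ := by
        by_contra! h
        exact hy ⟨y, by simpa using h, rfl⟩
      have hy1 : √(1 + ‖y‖ ^ 2) ≤ 1 + ‖y‖ := sqrt_one_add_sq_le (norm_nonneg y)
      have hy0 : 0 < √(1 + ‖y‖ ^ 2) := one_pos.trans_le (one_le_sqrt_one_add_sq _)
      -- The radius 2 R' + 1 was chosen for this: ‖y‖ - R' ≥ (1 + ‖y‖) / 2 beyond it.
      have hxy : (1 + ‖y‖) / 2 ≤ ‖x - y‖ := by
        have := norm_sub_norm_le y x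
        rw [norm_sub_rev] at this
        linarith
      rw [chordal_coe_coe]
      calc 1 / (2 * (1 + R')) = (1 + ‖y‖) / 2 / ((1 + R') * (1 + ‖y‖)) := by
            have : 1 + ‖y‖ ≠ 0 := by positivity
            field_simp
        _ ≤ _ := by gcongr
  | coe x₀ =>
    have h1 : ((↑) : Eu n → ExtEu n) ⁻¹' U ∈ 𝓝 x₀ := OnePoint.continuous_coe.continuousAt hU
    obtain ⟨a, ha, hball⟩ := Metric.mem_nhds_iff.1 h1
    set A := 1 + ‖x₀‖ + a with hA
    have hApos : 0 < A := by positivity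
    refine ⟨_, OnePoint.isOpenEmbedding_coe.image_mem_nhds.2
      (ball_mem_nhds x₀ (half_pos ha)), (a / 2) / ((A + a / 2) * A), by positivity, ?_⟩
    rintro x hx _ ⟨y, hy, rfl⟩
    have hxa : a ≤ dist x x₀ := by
      by_contra! h
      exact hx (hball h)
    have hya : dist y x₀ < a / 2 := hy
    have hd : a / 2 ≤ ‖x - y‖ := by
      rw [← dist_eq_norm]
      linarith [dist_triangle x y x₀]
    have hyn : ‖y‖ ≤ ‖x₀‖ + a / 2 := by
      have := norm_le_norm_add_norm_sub' y x₀
      rw [← dist_eq_norm] at this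
      linarith
    have hy1 : √(1 + ‖y‖ ^ 2) ≤ A := (sqrt_one_add_sq_le (norm_nonneg y)).trans (by linarith)
    have hy0 : 0 < √(1 + ‖y‖ ^ 2) := one_pos.trans_le (one_le_sqrt_one_add_sq _)
    have hx1 : √(1 + ‖x‖ ^ 2) ≤ A + ‖x - y‖ := by
      refine (sqrt_one_add_sq_le (norm_nonneg x)).trans ?_
      linarith [norm_le_norm_add_norm_sub' x y]
    have hx0 : 0 < √(1 + ‖x‖ ^ 2) := one_pos.trans_le (one_le_sqrt_one_add_sq _)
    rw [chordal_coe_coe]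
    -- The quotient s / (A + s) increases with s, so the bound for s = ‖x - y‖ follows from the one
    -- for s = a / 2, however far away x is.
    calc a / 2 / ((A + a / 2) * A) ≤ ‖x - y‖ / ((A + ‖x - y‖) * A) := by
          rw [div_le_div_iff₀ (by positivity) (by positivity)]
          nlinarith [mul_le_mul_of_nonneg_left hd (by positivity : 0 ≤ A * A)]
      _ ≤ _ := by gcongr

/-! ### Keeping the continua away from the boundary -/

theorem exists_lt_mul_log {c b : ℝ} (hc : 0 < c) (hb : 0 < b) (M : ℝ) :
    ∃ a, 0 < a ∧ a < b ∧ M < c * Real.log (b / a) := by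
  refine ⟨b * Real.exp (-((|M| + 1) / c)), by positivity, ?_, ?_⟩
  · have : 0 < (|M| + 1) / c := by positivity
    exact mul_lt_of_lt_one_right hb (Real.exp_lt_one_iff.2 (by linarith))
  · have h1 : b / (b * Real.exp (-((|M| + 1) / c))) = Real.exp ((|M| + 1) / c) := by
      rw [Real.exp_neg]; field_simp
    rw [h1, Real.log_exp, mul_div_cancel₀ _ hc.ne']
    linarith [le_abs_self M]

/-- If, for a family of connected sets `C m` of chordal diameter at least `δ`, a set `C m` and the
complement of `D` can only meet all spheres of a ring whose modulus is bounded, then the sets `C m`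
stay away from each boundary point of `D`. -/
theorem exists_nhds_disjoint {n : ℕ} {D : Set (Eu n)} (hD : IsOpen D)
    (hbd : NondegenerateBoundary D) {δ : ℝ} (hδ : 0 < δ) {ι : Type*} {C : ι → Set (Eu n)}
    (hC : ∀ m, IsConnected (C m)) (hCδ : ∀ m, ENNReal.ofReal δ ≤ chordalDiam (toExt (C m)))
    {c M : ℝ} (hc : 0 < c)
    (hring : ∀ m, ∀ (x₀ : Eu n) (a b : ℝ), 0 < a → a ≤ b →
      (∀ r ∈ Ioo a b, (∃ x ∈ C m, dist x x₀ = r) ∧ ∃ y ∉ D, dist y x₀ = r) →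
      c * Real.log (b / a) ≤ M)
    {p : ExtEu n} (hp : p ∈ extBoundary D) :
    ∃ U ∈ 𝓝 p, ∀ m, ∀ x ∈ C m, (x : ExtEu n) ∉ U := by
  have hpK : p ∈ connectedComponentIn (extBoundary D) p := mem_connectedComponentIn hp
  obtain ⟨q, hq, hqp⟩ := (hbd p hp).exists_ne p
  have hconn := isPreconnected_connectedComponentIn (F := extBoundary D) (x := p)
  have hhit {x₀ : Eu n} {r : ℝ} (h : ∃ y : Eu n,
      (y : ExtEu n) ∈ connectedComponentIn (extBoundary D) p ∧ dist y x₀ = r) :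
      ∃ y ∉ D, dist y x₀ = r := by
    obtain ⟨y, hy, hyr⟩ := h
    exact ⟨y, notMem_of_mem_extBoundary hD (connectedComponentIn_subset _ _ hy), hyr⟩
  have hChit {m : ι} {x y x₀ : Eu n} {r : ℝ} (hx : x ∈ C m) (hy : y ∈ C m) (hxr : dist x x₀ ≤ r)
      (hry : r ≤ dist y x₀) : ∃ z ∈ C m, dist z x₀ = r := by
    obtain ⟨z, hz, hzr⟩ := (hC m).isPreconnected.intermediate_value hx hy
      (f := fun z => dist z x₀) (by fun_prop) ⟨hxr, hry⟩
    exact ⟨z, hz, hzr⟩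
  induction p using OnePoint.rec with
  | infty =>
    induction q using OnePoint.rec with
    | infty => exact absurd rfl hqp
    | coe q =>
      -- Beyond radius ‖q‖ every sphere about 0 separates q from ∞. Points of norm at least 4 / δ
      -- have mutual chordal distance at most δ / 2, so C m cannot lie entirely out there.
      set a := max (‖q‖ + 1) (4 / δ) with ha
      have ha0 : 0 < a := lt_max_of_lt_left (by positivity)
      obtain ⟨κ, hκ0, hκ1, hκ⟩ := exists_lt_mul_log hc one_pos M
      have hlog : M < c * Real.log (a / κ / a) := by
        have : a / κ / a = 1 / κ := by field_simp
        rwa [this]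
      have hab : a ≤ a / κ := by
        rw [le_div_iff₀ hκ0]
        nlinarith
      refine ⟨(((↑) : Eu n → ExtEu n) '' closedBall 0 (a / κ))ᶜ,
        (OnePoint.isOpen_compl_image_coe.2 ⟨isClosed_closedBall,
          isCompact_closedBall _ _⟩).mem_nhds OnePoint.infty_notMem_image_coe,
        fun m x hx hxU => ?_⟩
      have hxb : a / κ < dist x 0 := by
        by_contra! h
        exact hxU ⟨x, h, rfl⟩
      obtain ⟨x', hx', hx'a⟩ : ∃ x' ∈ C m, dist x' 0 ≤ a := by
        by_contra! h
        obtain ⟨u, hu, v, hv, huv⟩ :=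
          exists_lt_chordal_of_le_chordalDiam hδ (half_lt_self hδ) (hCδ m)
        have hR : (0 : ℝ) < 4 / δ := by positivity
        have h1 := chordal_le_inv_add_inv (x := u) (y := v) hR
          ((le_max_right _ _).trans ((h u hu).le.trans_eq (dist_zero_right u)))
          ((le_max_right _ _).trans ((h v hv).le.trans_eq (dist_zero_right v)))
        have h2 : 2 / (4 / δ) = δ / 2 := by field_simp; norm_num
        linarith
      refine (hring m 0 a (a / κ) ha0 hab fun r hr => ⟨?_, hhit ?_⟩).not_gt hlog
      · exact hChit hx' hx (hx'a.trans hr.1.le) (hr.2.le.trans hxb.le)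
      · have hr0 : 0 < r := ha0.trans hr.1
        have hqr : ‖q‖ ≤ r := by linarith [le_max_left (‖q‖ + 1) (4 / δ), hr.1]
        refine exists_dist_eq_of_isPreconnected hconn hq hpK hr0.le ?_ ?_
        · rw [radial_infty]; positivity
        · rw [radial_coe, dist_zero_right]
          gcongr
  | coe x₀ =>
    obtain ⟨b₀, hb₀, hKb₀⟩ : ∃ b₀ > 0, ∀ r ∈ Ioo 0 b₀, ∃ y : Eu n,
        (y : ExtEu n) ∈ connectedComponentIn (extBoundary D) x₀ ∧ dist y x₀ = r := by
      have hx₀r {r : ℝ} (hr : 0 < r) : 1 / (1 + r) ≤ radial x₀ (x₀ : ExtEu n) := by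
        rw [radial_coe, dist_self]
        gcongr
      induction q using OnePoint.rec with
      | infty =>
        refine ⟨1, one_pos, fun r hr => exists_dist_eq_of_isPreconnected hconn hpK hq hr.1.le ?_
          (hx₀r hr.1)⟩
        have := hr.1
        rw [radial_infty]; positivity
      | coe q =>
        refine ⟨dist q x₀, dist_pos.2 fun h => hqp (by rw [h]), fun r hr =>
          exists_dist_eq_of_isPreconnected hconn hpK hq hr.1.le ?_ (hx₀r hr.1)⟩
        have := hr.1
        rw [radial_coe]
        gcongr
        exact hr.2.le
    -- A set inside the ball of radius δ / 4 has diameter at most δ / 2, so C m reaches distance b;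
    -- below b₀ the boundary component meets every sphere about x₀.
    set b := min b₀ (δ / 4) with hb
    have hb0 : 0 < b := lt_min hb₀ (by positivity)
    obtain ⟨a, ha0, hab, hlog⟩ := exists_lt_mul_log hc hb0 M
    refine ⟨_, OnePoint.isOpenEmbedding_coe.image_mem_nhds.2 (ball_mem_nhds x₀ ha0), ?_⟩
    rintro m x hx ⟨x', hx', hxx'⟩
    obtain rfl : x' = x := OnePoint.coe_injective hxx'
    obtain ⟨x'', hx'', hx''b⟩ : ∃ x'' ∈ C m, b ≤ dist x'' x₀ := by
      by_contra! h
      obtain ⟨u, hu, v, hv, huv⟩ :=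
        exists_lt_chordal_of_le_chordalDiam hδ (half_lt_self hδ) (hCδ m)
      have h1 := chordal_le_dist u v
      have h2 := dist_triangle_right u v x₀
      have h3 := min_le_right b₀ (δ / 4)
      linarith [h u hu, h v hv]
    refine (hring m x₀ a b ha0 hab.le fun r hr => ⟨?_, hhit ?_⟩).not_gt hlog
    · exact hChit hx hx'' ((mem_ball.1 hx').le.trans hr.1.le) (hr.2.le.trans hx''b)
    · exact hKb₀ r ⟨ha0.trans hr.1, hr.2.trans_le (min_le_left _ _)⟩

end Approaching

end

theorem lemma5p1 {n : ℕ} (hn : 2 ≤ n) (δ : ℝ) (hδ : 0 < δ)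
    (D D₀ : Set (Approaching.Eu n))
    (hD : Approaching.IsRegion D) (hD₀ : Approaching.IsRegion D₀)
    (E : Set (Approaching.Eu n)) (hE : IsCompact E) (hED₀ : E ⊆ D₀)
    (Q : Approaching.Eu n → ENNReal) (hQ : AEMeasurable Q MeasureTheory.volume)
    (hQ0 : ∀ y, y ∉ D₀ → Q y = 0)
    (hQint : Approaching.IntegrableOverSpheres D₀ Q)
    (hbd : Approaching.NondegenerateBoundary D)
    (f : ℕ → Approaching.Eu n → Approaching.Eu n)
    (hf : ∀ m, f m ∈ Approaching.classR E Q δ D D₀)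
    (hker : Approaching.ConvergesToKernel (fun m => f m '' D) D₀) :
    ∃ δ' : ℝ, 0 < δ' ∧ ∀ m,
      ENNReal.ofReal δ' ≤
        Approaching.chordalDist (Approaching.toExt (D ∩ f m ⁻¹' E)) (Approaching.extBoundary D) ∧
      f m ∈ Approaching.classF E Q δ' D D₀ := by
  open Approaching in
  suffices h : ∃ κ : ℝ, 0 < κ ∧ ∀ m, ∀ x ∈ D ∩ f m ⁻¹' E, ∀ y ∈ extBoundary D,
      κ ≤ chordal (x : ExtEu n) y by
    obtain ⟨κ, hκ, h⟩ := h
    have hdist (m : ℕ) : ENNReal.ofReal κ ≤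
        chordalDist (toExt (D ∩ f m ⁻¹' E)) (extBoundary D) := by
      refine le_iInf₂ ?_
      rintro _ ⟨x, hx, rfl⟩
      exact le_iInf₂ fun y hy => ENNReal.ofReal_le_ofReal (h m x hx y hy)
    exact ⟨κ, hκ, fun m => ⟨hdist m, (hf m).1, (hf m).2.1, hdist m⟩⟩
  obtain ⟨A₀, -, hker⟩ := hker
  obtain ⟨N, M, hNM⟩ := exists_uniform_density hn hD.1 hD₀.1 hE hED₀ hQ hQint (fun m => (hf m).1)
    (hker id strictMono_id).1.2.2
  obtain ⟨c, hc, hmod⟩ := exists_mul_log_le_lintegral_pow n hn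
  have hnhds : ∀ p ∈ extBoundary D, ∃ U ∈ 𝓝 p, ∀ m, ∀ x ∈ D ∩ f m ⁻¹' E, (x : ExtEu n) ∉ U := by
    intro p hp
    -- The uniform densities exist only for m ≥ N. The bound is max M 0 because `ENNReal.ofReal`
    -- sends negative numbers to 0.
    obtain ⟨U, hU, hUm⟩ := exists_nhds_disjoint hD.1 hbd hδ
      (C := fun m : {m // N ≤ m} => D ∩ f m ⁻¹' E) (fun m => (hf m).2.1.2) (fun m => (hf m).2.2)
      (c := c) (M := max M 0) hc (fun m x₀ a b ha hab h => by
        obtain ⟨ρ, hρ, hρM, hρ1⟩ := hNM m m.2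
        have h1 := (hmod ρ x₀ a b hρ ha hab fun r hr => by
          obtain ⟨⟨x, hx, hxr⟩, y, hy, hyr⟩ := h r hr
          refine ⟨x, hxr, y, hyr, fun γ K hγ h1 h2 => hρ1 γ K hγ ?_ ?_⟩
          · rw [h1]; exact hx
          · rw [h2]; exact hy).trans hρM
        exact (ENNReal.ofReal_le_ofReal_iff' .. |>.1 h1).elim (fun h => h.trans (le_max_left _ _))
          fun h => h.trans (le_max_right _ _)) hp
    -- The finitely many sets with m < N are compact in D, and D is open, so their union is closed
    -- and misses p.
    have hcl : IsClosed (⋃ m ∈ Finset.range N, toExt (D ∩ f m ⁻¹' E)) :=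
      ((Finset.range N).isCompact_biUnion fun m _ =>
        (hf m).2.1.1.image OnePoint.continuous_coe).isClosed
    refine ⟨U ∩ (⋃ m ∈ Finset.range N, toExt (D ∩ f m ⁻¹' E))ᶜ,
      inter_mem hU (hcl.isOpen_compl.mem_nhds ?_), fun m x hx hxU => ?_⟩
    · simp only [mem_compl_iff, mem_iUnion, not_exists]
      rintro m - ⟨x, hx, rfl⟩
      exact notMem_of_mem_extBoundary hD.1 hp hx.1
    · rcases lt_or_ge m N with h | h
      · exact hxU.2 (mem_iUnion₂.2 ⟨m, Finset.mem_range.2 h, x, hx, rfl⟩)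
      · exact hUm ⟨m, h⟩ x hx hxU.1
  -- The extended boundary is closed in a compact space, so finitely many of the local lower bounds
  -- suffice, and their minimum is the required constant.
  refine IsCompact.induction_on (isClosed_frontier.isCompact : IsCompact (extBoundary D))
    (p := fun S => ∃ κ : ℝ, 0 < κ ∧ ∀ m, ∀ x ∈ D ∩ f m ⁻¹' E, ∀ y ∈ S,
      κ ≤ chordal (x : ExtEu n) y) ⟨1, one_pos, by simp⟩ ?_ ?_ ?_
  · rintro S T hST ⟨κ, hκ, h⟩
    exact ⟨κ, hκ, fun m x hx y hy => h m x hx y (hST hy)⟩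
  · rintro S T ⟨κ, hκ, h⟩ ⟨κ', hκ', h'⟩
    refine ⟨min κ κ', lt_min hκ hκ', fun m x hx y hy => hy.elim
      (fun hy => (min_le_left _ _).trans (h m x hx y hy))
      (fun hy => (min_le_right _ _).trans (h' m x hx y hy))⟩
  · intro p hp
    obtain ⟨U, hU, hUm⟩ := hnhds p hp
    obtain ⟨V, hV, κ, hκ, h⟩ := exists_le_chordal hU
    exact ⟨V, mem_nhdsWithin_of_mem_nhds hV, κ, hκ, fun m x hx y hy => h x (hUm m x hx) y hy⟩
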